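/- Let $n\ge 1$, let $1\le q\le\infty$, $1\le r<\infty$, let $j,k$ be integers with $0\le j<k$, and let $p\in[1,\infty]$ be defined by $$\frac1p=\frac{j}{kr}+\frac{k-j}{kq}\qquad\Big(\text{with } \tfrac1\infty=0\Big).$$ Then there exists a constant $C<\infty$, depending only on $n,j,k,q,r$ (and in particular independent of $u$), such that $$\|\nabla^{j}u\|_{L^p(\mathbb{R}^n)}\le C\,\|\nabla^{k}u\|_{L^r(\mathbb{R}^n)}^{j/k}\,\|u\|_{L^q(\mathbb{R}^n)}^{1-j/k}\qquad\text{for all real-valued } u\in L^q(\mathbb{R}^n)\cap W^{k,r}(\mathbb{R}^n).$$ Here $\nabla^m u$ denotes the vector of all weak partial derivatives of $u$ of order $m$ (so $\nabla^0u=u$), $|\nabla^m u|$ is its Euclidean norm, a factor of the form $0^0$ is read as $1$, and $W^{k,r}(\mathbb{R}^n)$ is the Sobolev space of functions all of whose weak derivatives of order at most $k$ exist and belong to $L^r(\mathbb{R}^n)$. -/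

import Mathlib

open MeasureTheory
open scoped ENNReal NNReal ContDiff

/-- The `m`-th order partial derivative `∂_{α 0} ⋯ ∂_{α (m-1)} φ` of a function `φ` on `ℝⁿ`, in the
classical sense. It is only applied to smooth functions `φ`. -/
noncomputable def partialDeriv {n m : ℕ} (α : Fin m → Fin n)
    (φ : EuclideanSpace ℝ (Fin n) → ℝ) (x : EuclideanSpace ℝ (Fin n)) : ℝ :=
  iteratedFDeriv ℝ m φ x (fun i => EuclideanSpace.single (α i) (1 : ℝ))

/-- `D` is the `m`-th weak gradient `∇ᵐu` of the locally integrable function `u` on `ℝⁿ`: the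
family, indexed by `α : Fin m → Fin n`, of all weak partial derivatives of order `m` of `u`, that is,
`∫ u ∂^α φ = (-1)^m ∫ D_α φ` for every smooth compactly supported `φ`. The values of `D` carry the
Euclidean norm. -/
structure IsWeakGradient {n : ℕ} (m : ℕ) (u : EuclideanSpace ℝ (Fin n) → ℝ)
    (D : EuclideanSpace ℝ (Fin n) → EuclideanSpace ℝ (Fin m → Fin n)) : Prop where
  locallyIntegrable : LocallyIntegrable u volume
  locallyIntegrable_grad : LocallyIntegrable D volume
  integral_eq : ∀ (α : Fin m → Fin n) (φ : EuclideanSpace ℝ (Fin n) → ℝ),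
    ContDiff ℝ ∞ φ → HasCompactSupport φ →
      ∫ x, u x * partialDeriv α φ x = (-1) ^ m * ∫ x, D x α * φ x

/-- `u` belongs to the Sobolev space `W^{k,r}(ℝⁿ)`: for every `m ≤ k` the weak gradient `∇ᵐu` exists
and belongs to `Lʳ` (for `m = 0` this says that `u ∈ Lʳ`). -/
def MemSobolev {n : ℕ} (k : ℕ) (r : ℝ≥0∞) (u : EuclideanSpace ℝ (Fin n) → ℝ) : Prop :=
  ∀ m ≤ k, ∃ D : EuclideanSpace ℝ (Fin n) → EuclideanSpace ℝ (Fin m → Fin n),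
    IsWeakGradient m u D ∧ MemLp D r volume

/-!
The norms of the derivatives of a smooth function, taken at exponents whose reciprocals are in
arithmetic progression, form a sequence that is log-convex up to constant factors; this gives the
Gagliardo–Nirenberg inequality for smooth functions, and mollification transfers it to `u`.

The case `j = 1`, `k = 2` on the line carries the analysis. On an interval of radius `l`,
`|f'| ≤ ∫ |f''| + l⁻² ∫ |f|` (`sq_mul_abs_deriv_le`), and Hölder's inequality bounds the two terms by
powers of `l` times local norms. Around each point where `|f'| ≥ δ` the radius can be chosen so that
the two bounds agree (`exists_balanced_radius`), which makes `∫ |f'|^p` over that interval at most a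
constant times the product of the local norms of `f''` and `f`, to the power `p / 2`. The
Besicovitch covering theorem extracts finitely many disjoint families of such intervals, and Hölder's
inequality for sums finishes the proof (`exists_setLIntegral_deriv_rpow_le`). Unlike integration by
parts this also works for `p < 2`.

Fubini's theorem gives `‖∂ᵢ w‖_P² ≤ C ‖∂ᵢ² w‖_R ‖w‖_Q` on `ℝⁿ` (`exists_eLpNorm_partial_sq_le`).
Applied to all partial derivatives of `w`, this is the log-convexity inequality, and
`NNReal.pow_le_of_sq_le_mul` interpolates between the orders `0` and `k`
(`exists_supPartialNorm_pow_le`). That step cancels norms, so it needs them to be finite: for the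
mollification `w = u ⋆ ψ` every derivative is `u ⋆ ∂^α ψ`, which lies in `L^q ∩ L^r` because `u` does.
For `|α| = j` and `|α| = k` this derivative is also the mollification of the weak derivative of `u`,
so Young's inequality bounds the right-hand side uniformly and Fatou's lemma gives the limit.
-/

/-! ### A balanced estimate on intervals -/

theorem abs_sub_le_integral_abs_deriv {f' f'' : ℝ → ℝ} (hf' : ∀ x, HasDerivAt f' (f'' x) x)
    (hc : Continuous f'') {a b y z : ℝ} (hy : y ∈ Set.Icc a b) (hz : z ∈ Set.Icc a b) :
    |f' z - f' y| ≤ ∫ w in a..b, |f'' w| := by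
  wlog h : y ≤ z generalizing y z
  · rw [abs_sub_comm]
    exact this hz hy (le_of_not_ge h)
  rw [← intervalIntegral.integral_eq_sub_of_hasDerivAt (fun w _ => hf' w)
    (hc.intervalIntegrable _ _)]
  exact (intervalIntegral.abs_integral_le_integral_abs h).trans
    (intervalIntegral.integral_mono_interval hy.1 h hz.2
      (Filter.Eventually.of_forall fun _ => abs_nonneg _) (hc.abs.intervalIntegrable _ _))

theorem continuous_integral_symm_interval {h : ℝ → ℝ} (hh : Continuous h) (x : ℝ) :
    Continuous fun l => ∫ z in (x - l)..(x + l), h z := by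
  have hi : ∀ a b, IntervalIntegrable h volume a b := fun a b => hh.intervalIntegrable a b
  have hp := intervalIntegral.continuous_primitive hi 0
  have : (fun l => ∫ z in (x - l)..(x + l), h z) =
      fun l => (∫ z in (0 : ℝ)..(x + l), h z) - ∫ z in (0 : ℝ)..(x - l), h z := by
    funext l
    rw [intervalIntegral.integral_interval_sub_left (hi _ _) (hi _ _)]
  rw [this]
  exact (hp.comp (by fun_prop)).sub (hp.comp (by fun_prop))

/-- Averaging the mean value theorem over all pairs of points of the interval `[x - l, x + l]` at
distance `l`. -/
theorem sq_mul_abs_deriv_le {f f' f'' : ℝ → ℝ} (hf : ∀ x, HasDerivAt f (f' x) x)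
    (hf' : ∀ x, HasDerivAt f' (f'' x) x) (hc : Continuous f'') {x l y : ℝ} (hl : 0 < l)
    (hy : y ∈ Set.Icc (x - l) (x + l)) :
    l ^ 2 * |f' y| ≤
      l ^ 2 * (∫ z in (x - l)..(x + l), |f'' z|) + ∫ z in (x - l)..(x + l), |f z| := by
  set J := ∫ z in (x - l)..(x + l), |f'' z| with hJ
  have hfc : Continuous fun z => |f z| :=
    (continuous_iff_continuousAt.2 fun z => (hf z).continuousAt).abs
  have key : ∀ u ∈ Set.Icc 0 l, l * |f' y| ≤ l * J + (|f (x + u)| + |f (x - l + u)|) := by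
    intro u hu
    obtain ⟨ξ, hξ, hξ'⟩ := exists_hasDerivAt_eq_slope f f' (a := x - l + u) (b := x + u)
      (by linarith) (fun z _ => (hf z).continuousAt.continuousWithinAt) (fun z _ => hf z)
    have h1 : |f' y - f' ξ| ≤ J := abs_sub_le_integral_abs_deriv hf' hc
      ⟨by linarith [hξ.1, hu.1], by linarith [hξ.2, hu.2]⟩ hy
    have h2 : l * |f' ξ| ≤ |f (x + u)| + |f (x - l + u)| := by
      have : l * f' ξ = f (x + u) - f (x - l + u) := by
        rw [hξ', show x + u - (x - l + u) = l by ring]; field_simp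
      calc l * |f' ξ| = |l * f' ξ| := by rw [abs_mul, abs_of_pos hl]
        _ ≤ _ := by rw [this]; exact abs_sub _ _
    have h3 : |f' y| ≤ J + |f' ξ| := by
      have := abs_sub_abs_le_abs_sub (f' y) (f' ξ); linarith
    nlinarith
  have hi : ∀ c, IntervalIntegrable (fun u => |f (c + u)|) volume 0 l := fun c =>
    (hfc.comp (continuous_const.add continuous_id)).intervalIntegrable _ _
  have := intervalIntegral.integral_mono_on hl.le (by simp)
    (intervalIntegrable_const.add ((hi x).add (hi (x - l)))) key
  rw [intervalIntegral.integral_add intervalIntegrable_const ((hi x).add (hi (x - l))),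
    intervalIntegral.integral_add (hi x) (hi (x - l)),
    intervalIntegral.integral_comp_add_left (fun z => |f z|),
    intervalIntegral.integral_comp_add_left (fun z => |f z|)] at this
  simp only [intervalIntegral.integral_const, sub_zero, smul_eq_mul, add_zero] at this
  have h4 := intervalIntegral.integral_add_adjacent_intervals (μ := volume)
    (hfc.intervalIntegrable (x - l) x) (hfc.intervalIntegrable x (x + l))
  rw [sub_add_cancel] at this
  nlinarith

/-- For a function `f` of class `C²` on the line, around every point where `|f'| ≥ δ` there is an
interval on which the two terms of the bound `sq_mul_abs_deriv_le` are equal, so that `|f'|²` is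
bounded by their product. Its radius is bounded in terms of `δ` only. Here `s` and `t` stand for the
reciprocals `1 / r` and `1 / q` of the exponents of `f''` and `f`, and `h` and `g` for the densities
`|f''|^r` and `|f|^q`. For `q = ∞` the density plays no role and `M` is a bound for `|f|`. -/
theorem exists_balanced_radius {f f' f'' h g : ℝ → ℝ} (hf : ∀ x, HasDerivAt f (f' x) x)
    (hf' : ∀ x, HasDerivAt f' (f'' x) x) (hc : Continuous f'')
    (hh : Continuous h) (hh0 : ∀ x, 0 ≤ h x)
    (hg : Continuous g) (hg0 : ∀ x, 0 ≤ g x) (hgi : Integrable g)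
    {s t M δ : ℝ} (hs : 0 < s) (hs1 : s ≤ 1) (ht : 0 ≤ t) (hM : 0 ≤ M) (hδ : 0 < δ)
    (hH : ∀ a b, a ≤ b → ∫ z in a..b, |f'' z| ≤ (b - a) ^ (1 - s) * (∫ z in a..b, h z) ^ s)
    (hG : ∀ a b, a ≤ b → ∫ z in a..b, |f z| ≤ M * (b - a) ^ (1 - t) * (∫ z in a..b, g z) ^ t) :
    ∃ R, ∀ x, δ ≤ |f' x| → ∃ l, 0 < l ∧ l ≤ R ∧ ∀ y ∈ Set.Icc (x - l) (x + l),
      |f' y| ^ 2 ≤ 16 * l ^ (-(s + t)) * (M * (∫ z in (x - l)..(x + l), h z) ^ s *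
        (∫ z in (x - l)..(x + l), g z) ^ t) := by
  set K := M * (∫ z, g z) ^ t with hK
  have hK0 : 0 ≤ K := mul_nonneg hM (Real.rpow_nonneg (integral_nonneg hg0) _)
  refine ⟨1 + 4 * K / δ, fun x hx => ?_⟩
  set R := 1 + 4 * K / δ with hR
  have hR1 : 1 ≤ R := by have : 0 ≤ 4 * K / δ := by positivity
                         linarith
  set H : ℝ → ℝ := fun l => ∫ z in (x - l)..(x + l), h z with hHdef
  set G : ℝ → ℝ := fun l => ∫ z in (x - l)..(x + l), g z with hGdef
  have hHc : Continuous H := by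
    exact continuous_integral_symm_interval hh x
  have hGc : Continuous G := by
    exact continuous_integral_symm_interval hg x
  have hH0 : ∀ l, 0 ≤ l → 0 ≤ H l := fun l hl =>
    intervalIntegral.integral_nonneg (by linarith) fun z _ => hh0 z
  have hG0 : ∀ l, 0 ≤ l → 0 ≤ G l := fun l hl =>
    intervalIntegral.integral_nonneg (by linarith) fun z _ => hg0 z
  set A : ℝ → ℝ := fun l => (2 * l) ^ (1 - s) * H l ^ s with hA
  set B : ℝ → ℝ := fun l => (l ^ 2)⁻¹ * (M * (2 * l) ^ (1 - t) * G l ^ t) with hB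
  have bound : ∀ l, 0 < l → ∀ y ∈ Set.Icc (x - l) (x + l), |f' y| ≤ A l + B l := by
    intro l hl y hy
    have h1 := sq_mul_abs_deriv_le hf hf' hc hl hy
    have h2 := hH (x - l) (x + l) (by linarith)
    have h3 := hG (x - l) (x + l) (by linarith)
    rw [show x + l - (x - l) = 2 * l by ring] at h2 h3
    have h4 : l ^ 2 * |f' y| ≤ l ^ 2 * (A l + B l) := by
      have : l ^ 2 * B l = M * (2 * l) ^ (1 - t) * G l ^ t := by
        simp only [hB]; field_simp
      rw [mul_add, this]
      refine h1.trans (add_le_add ?_ h3)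
      exact mul_le_mul_of_nonneg_left h2 (by positivity)
    exact le_of_mul_le_mul_left h4 (by positivity)
  have hxm : ∀ l, 0 < l → x ∈ Set.Icc (x - l) (x + l) := fun l hl =>
    ⟨by linarith, by linarith⟩
  -- at radius `R` the term with `f` is too small to account for `|f' x|`
  have hBR : B R ≤ A R := by
    by_contra hlt
    push Not at hlt
    have h1 := bound R (by linarith) x (hxm R (by linarith))
    have h2 : B R ≤ 2 * K / R := by
      have h5 : (2 * R) ^ (1 - t) ≤ 2 * R := by
        calc (2 * R) ^ (1 - t) ≤ (2 * R) ^ (1 : ℝ) :=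
              Real.rpow_le_rpow_of_exponent_le (by linarith) (by linarith)
          _ = 2 * R := Real.rpow_one _
      have h6 : G R ^ t ≤ (∫ z, g z) ^ t := by
        refine Real.rpow_le_rpow (hG0 R (by linarith)) ?_ ht
        simp only [hGdef]
        rw [intervalIntegral.integral_of_le (by linarith)]
        exact setIntegral_le_integral hgi (Filter.Eventually.of_forall hg0)
      have h7 : M * (2 * R) ^ (1 - t) * G R ^ t ≤ 2 * R * K := by
        rw [hK]
        calc M * (2 * R) ^ (1 - t) * G R ^ t ≤ M * (2 * R) * (∫ z, g z) ^ t := by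
              gcongr
              exact Real.rpow_nonneg (hG0 R (by linarith)) _
          _ = _ := by ring
      calc B R ≤ (R ^ 2)⁻¹ * (2 * R * K) := by
            simp only [hB]; gcongr
        _ = 2 * K / R := by field_simp
    have h3 : δ < 4 * K / R := by
      calc δ ≤ |f' x| := hx
        _ ≤ A R + B R := h1
        _ < 2 * K / R + 2 * K / R := by linarith
        _ = 4 * K / R := by ring
    rw [lt_div_iff₀ (by linarith), hR, mul_add, mul_div_cancel₀ _ hδ.ne'] at h3
    linarith
  -- at small radii the term with `f''` is too small
  obtain ⟨l₀, hl₀, hl₀1, hAB⟩ : ∃ l₀, 0 < l₀ ∧ l₀ ≤ 1 / 2 ∧ A l₀ ≤ B l₀ := by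
    have hlim : Filter.Tendsto (fun l => H l ^ s) (nhds 0) (nhds 0) := by
      have : Filter.Tendsto (fun l => H l ^ s) (nhds 0) (nhds (H 0 ^ s)) :=
        (hHc.rpow_const fun _ => Or.inr hs.le).tendsto 0
      simpa [hHdef, Real.zero_rpow hs.ne'] using this
    have hev := (hlim.eventually_lt_const (show (0 : ℝ) < δ / 2 by linarith)).filter_mono
      (nhdsWithin_le_nhds (s := Set.Ioi 0))
    have hev2 : ∀ᶠ l : ℝ in nhdsWithin 0 (Set.Ioi 0), l ∈ Set.Ioc (0 : ℝ) (1 / 2) :=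
      Ioc_mem_nhdsGT (by norm_num)
    obtain ⟨l, hl1, hl2⟩ := (hev.and hev2).exists
    refine ⟨l, hl2.1, hl2.2, ?_⟩
    have h1 := bound l hl2.1 x (hxm l hl2.1)
    have h2 : (2 * l) ^ (1 - s) ≤ 1 :=
      Real.rpow_le_one (by linarith [hl2.1]) (by linarith [hl2.2]) (by linarith)
    have h3 : A l ≤ H l ^ s := by
      simp only [hA]
      exact mul_le_of_le_one_left (Real.rpow_nonneg (hH0 l hl2.1.le) _) h2
    linarith
  obtain ⟨l, hl, hle⟩ : ∃ l ∈ Set.Icc l₀ R, A l = B l := by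
    have hpos : ∀ l ∈ Set.Icc l₀ R, l ≠ 0 := fun l hl => (hl₀.trans_le hl.1).ne'
    have hAc : ContinuousOn A (Set.Icc l₀ R) := by
      refine ContinuousOn.mul (ContinuousOn.rpow_const (by fun_prop) fun l hl => Or.inl ?_)
        (hHc.rpow_const fun _ => Or.inr hs.le).continuousOn
      exact mul_ne_zero two_ne_zero (hpos l hl)
    have hBc : ContinuousOn B (Set.Icc l₀ R) := by
      refine ContinuousOn.mul (ContinuousOn.inv₀ (by fun_prop) fun l hl =>
        pow_ne_zero 2 (hpos l hl)) (ContinuousOn.mul (continuousOn_const.mul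
        (ContinuousOn.rpow_const (by fun_prop) fun l hl => Or.inl ?_))
        (hGc.rpow_const fun _ => Or.inr ht).continuousOn)
      exact mul_ne_zero two_ne_zero (hpos l hl)
    have hle : l₀ ≤ R := by linarith
    exact isPreconnected_Icc.intermediate_value₂ (Set.left_mem_Icc.2 hle)
      (Set.right_mem_Icc.2 hle) hAc hBc hAB hBR
  have hlpos : 0 < l := hl₀.trans_le hl.1
  refine ⟨l, hlpos, hl.2, fun y hy => ?_⟩
  have h1 := bound l hlpos y hy
  have hA0 : 0 ≤ A l := mul_nonneg (by positivity) (Real.rpow_nonneg (hH0 l hlpos.le) _)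
  have hX : 0 ≤ M * H l ^ s * G l ^ t :=
    mul_nonneg (mul_nonneg hM (Real.rpow_nonneg (hH0 l hlpos.le) _))
      (Real.rpow_nonneg (hG0 l hlpos.le) _)
  calc |f' y| ^ 2 ≤ (2 * A l) ^ 2 := by
        refine pow_le_pow_left₀ (abs_nonneg _) ?_ 2
        linarith
    _ = 4 * (A l * B l) := by rw [← hle]; ring
    _ = (4 * ((2 * l) ^ (1 - s) * (2 * l) ^ (1 - t)) * (l ^ 2)⁻¹) * (M * H l ^ s * G l ^ t) := by
        simp only [hA, hB]; ring
    _ ≤ (16 * l ^ (-(s + t))) * (M * H l ^ s * G l ^ t) := by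
        refine mul_le_mul_of_nonneg_right ?_ hX
        rw [← Real.rpow_add (by positivity), Real.mul_rpow (by norm_num) hlpos.le]
        have e1 : l ^ (1 - s + (1 - t)) * (l ^ 2)⁻¹ = l ^ (-(s + t)) := by
          rw [← Real.rpow_natCast, ← Real.rpow_neg hlpos.le, ← Real.rpow_add hlpos]
          congr 1; push_cast; ring
        have e2 : (2 : ℝ) ^ (1 - s + (1 - t)) ≤ 4 := by
          calc (2 : ℝ) ^ (1 - s + (1 - t)) ≤ (2 : ℝ) ^ (2 : ℝ) :=
                Real.rpow_le_rpow_of_exponent_le (by norm_num) (by linarith)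
            _ = 4 := by norm_num
        calc 4 * (2 ^ (1 - s + (1 - t)) * l ^ (1 - s + (1 - t))) * (l ^ 2)⁻¹
            = 4 * 2 ^ (1 - s + (1 - t)) * (l ^ (1 - s + (1 - t)) * (l ^ 2)⁻¹) := by ring
          _ ≤ 4 * 4 * (l ^ (1 - s + (1 - t)) * (l ^ 2)⁻¹) := by gcongr
          _ = 16 * l ^ (-(s + t)) := by rw [e1]; norm_num

theorem ofReal_intervalIntegral_eq_setLIntegral {h : ℝ → ℝ} (hh : Continuous h)
    (hh0 : ∀ x, 0 ≤ h x) {a b : ℝ} (hab : a ≤ b) :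
    ENNReal.ofReal (∫ z in a..b, h z) = ∫⁻ z in Set.Icc a b, ENNReal.ofReal (h z) := by
  rw [intervalIntegral.integral_of_le hab, ← integral_Icc_eq_integral_Ioc,
    ofReal_integral_eq_lintegral_ofReal (hh.continuousOn.integrableOn_Icc)
      (Filter.Eventually.of_forall hh0)]

theorem tsum_setLIntegral_le {α ι : Type*} [MeasurableSpace α] {μ : Measure α} {S : Set ι}
    (hS : S.Countable) {B : ι → Set α} (hB : ∀ i, MeasurableSet (B i))
    (hd : S.PairwiseDisjoint B) (φ : α → ℝ≥0∞) :
    ∑' i : S, ∫⁻ x in B i, φ x ∂μ ≤ ∫⁻ x, φ x ∂μ := by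
  have := hS.to_subtype
  rw [← lintegral_iUnion (fun i : S => hB i)
    (fun i j hij => hd i.2 j.2 (fun h => hij (Subtype.ext h)))]
  exact setLIntegral_le_lintegral _ _

theorem ENNReal.tsum_mul_rpow_le {ι : Type*} (a b : ι → ℝ≥0∞) {x y : ℝ} (hx : 0 ≤ x)
    (hy : 0 ≤ y) (hxy : x + y = 1) :
    ∑' i, a i ^ x * b i ^ y ≤ (∑' i, a i) ^ x * (∑' i, b i) ^ y := by
  let _ : MeasurableSpace ι := ⊤
  simpa only [lintegral_count] using
    ENNReal.lintegral_mul_norm_pow_le (μ := Measure.count) (f := a) (g := b)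
      (measurable_from_top.aemeasurable) (measurable_from_top.aemeasurable) hx hy hxy

/-- The Gagliardo–Nirenberg inequality between the first and the second derivative on the line. The
balanced intervals around the points of `{|f'| ≥ δ}` are thinned out to `N` disjoint families by the
Besicovitch covering theorem, and Hölder's inequality sums the estimates over each of them. -/
theorem exists_setLIntegral_deriv_rpow_le : ∃ N : ℕ, ∀ {f f' f'' h g : ℝ → ℝ}
    (_ : ∀ x, HasDerivAt f (f' x) x) (_ : ∀ x, HasDerivAt f' (f'' x) x) (_ : Continuous f'')
    (_ : Continuous h) (_ : ∀ x, 0 ≤ h x)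
    (_ : Continuous g) (_ : ∀ x, 0 ≤ g x) (_ : Integrable g)
    {p s t M δ : ℝ} (_ : 0 < p) (_ : 0 < s) (_ : s ≤ 1) (_ : 0 ≤ t) (_ : p / 2 * s + p / 2 * t = 1)
    (_ : 0 ≤ M) (_ : 0 < δ)
    (_ : ∀ a b, a ≤ b → ∫ z in a..b, |f'' z| ≤ (b - a) ^ (1 - s) * (∫ z in a..b, h z) ^ s)
    (_ : ∀ a b, a ≤ b →
      ∫ z in a..b, |f z| ≤ M * (b - a) ^ (1 - t) * (∫ z in a..b, g z) ^ t),
    ∫⁻ x in {x | δ ≤ |f' x|}, ‖f' x‖ₑ ^ p ≤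
      N * (ENNReal.ofReal (2 * 16 ^ (p / 2) * M ^ (p / 2)) *
        ((∫⁻ x, ENNReal.ofReal (h x)) ^ (p / 2 * s) *
          (∫⁻ x, ENNReal.ofReal (g x)) ^ (p / 2 * t))) := by
  obtain ⟨N, τ, hτ, hN⟩ := HasBesicovitchCovering.no_satelliteConfig (α := ℝ)
  refine ⟨N, ?_⟩
  intro f f' f'' h g hf hf' hc hh hh0 hg hg0 hgi p s t M δ hp hs hs1 ht hpst hM hδ hH hG
  obtain ⟨R, hR⟩ := exists_balanced_radius hf hf' hc hh hh0 hg hg0 hgi hs hs1 ht hM hδ hH hG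
  choose! l hl0 hlR hl using hR
  set S : Set ℝ := {x | δ ≤ |f' x|} with hS
  let P : Besicovitch.BallPackage S ℝ :=
    { c := fun x => x
      r := fun x => l x
      rpos := fun x => hl0 x x.2
      r_bound := R
      r_le := fun x => hlR x x.2 }
  obtain ⟨u, hu, hu'⟩ := Besicovitch.exist_disjoint_covering_families hτ hN P
  have hcount : ∀ i, (u i).Countable := fun i =>
    (hu i).countable_of_nonempty_interior fun j _ =>
      (Metric.nonempty_ball.2 (P.rpos j)).mono Metric.ball_subset_interior_closedBall
  set B : S → Set ℝ := fun x => Metric.closedBall (P.c x) (P.r x) with hB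
  have hBm : ∀ x, MeasurableSet (B x) := fun x => Metric.isClosed_closedBall.measurableSet
  set D := ENNReal.ofReal (2 * 16 ^ (p / 2) * M ^ (p / 2)) with hD
  set φ : ℝ → ℝ≥0∞ := fun x => ENNReal.ofReal (h x) with hφ
  set γ : ℝ → ℝ≥0∞ := fun x => ENNReal.ofReal (g x) with hγ
  have hball : ∀ x : S, ∫⁻ y in B x, ‖f' y‖ₑ ^ p ≤
      D * ((∫⁻ y in B x, φ y) ^ (p / 2 * s) * (∫⁻ y in B x, γ y) ^ (p / 2 * t)) := by
    intro x
    have hlx := hl0 x x.2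
    have hBx : B x = Set.Icc ((x : ℝ) - l x) (x + l x) := Real.closedBall_eq_Icc
    set H := ∫ z in ((x : ℝ) - l x)..(x + l x), h z with hHdef
    set G := ∫ z in ((x : ℝ) - l x)..(x + l x), g z with hGdef
    have hH0 : 0 ≤ H := intervalIntegral.integral_nonneg (by linarith) fun z _ => hh0 z
    have hG0 : 0 ≤ G := intervalIntegral.integral_nonneg (by linarith) fun z _ => hg0 z
    rw [hBx, ← ofReal_intervalIntegral_eq_setLIntegral hh hh0 (by linarith),
      ← ofReal_intervalIntegral_eq_setLIntegral hg hg0 (by linarith), ← hHdef, ← hGdef]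
    set Y := 16 ^ (p / 2) * M ^ (p / 2) * (H ^ (p / 2 * s) * G ^ (p / 2 * t)) with hY
    have hY0 : 0 ≤ Y := by positivity
    have hpt : ∀ y ∈ Set.Icc ((x : ℝ) - l x) (x + l x),
        ‖f' y‖ₑ ^ p ≤ ENNReal.ofReal ((l x)⁻¹ * Y) := by
      intro y hy
      rw [← ofReal_norm, ENNReal.ofReal_rpow_of_nonneg (norm_nonneg _) hp.le]
      refine ENNReal.ofReal_le_ofReal ?_
      have h1 := hl x x.2 y hy
      calc ‖f' y‖ ^ p = (|f' y| ^ 2) ^ (p / 2) := by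
            rw [← Real.rpow_natCast, ← Real.rpow_mul (abs_nonneg _), Real.norm_eq_abs]
            congr 1; push_cast; ring
        _ ≤ (16 * l x ^ (-(s + t)) * (M * H ^ s * G ^ t)) ^ (p / 2) :=
            Real.rpow_le_rpow (by positivity) h1 (by positivity)
        _ = (l x)⁻¹ * Y := by
            rw [Real.mul_rpow (by positivity) (by positivity),
              Real.mul_rpow (by positivity) (by positivity),
              Real.mul_rpow (by positivity) (by positivity),
              Real.mul_rpow (by positivity) (by positivity),
              ← Real.rpow_mul hlx.le, ← Real.rpow_mul hH0, ← Real.rpow_mul hG0,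
              show -(s + t) * (p / 2) = -1 by linarith, Real.rpow_neg_one, hY, mul_comm s,
              mul_comm t]
            ring
    calc ∫⁻ y in Set.Icc ((x : ℝ) - l x) (x + l x), ‖f' y‖ₑ ^ p
        ≤ ∫⁻ _ in Set.Icc ((x : ℝ) - l x) (x + l x), ENNReal.ofReal ((l x)⁻¹ * Y) :=
          setLIntegral_mono measurable_const hpt
      _ = ENNReal.ofReal ((l x)⁻¹ * Y) * ENNReal.ofReal (2 * l x) := by
          rw [setLIntegral_const, Real.volume_Icc]
          congr 2; ring
      _ = ENNReal.ofReal (2 * Y) := by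
          rw [← ENNReal.ofReal_mul (by positivity)]
          congr 1; field_simp
      _ = _ := by
          rw [hD, ENNReal.ofReal_rpow_of_nonneg hH0 (by positivity),
            ENNReal.ofReal_rpow_of_nonneg hG0 (by positivity),
            ← ENNReal.ofReal_mul (by positivity), ← ENNReal.ofReal_mul (by positivity), hY]
          congr 1; ring
  have hfam : ∀ i, ∫⁻ y in ⋃ x ∈ u i, B x, ‖f' y‖ₑ ^ p ≤
      D * ((∫⁻ y, φ y) ^ (p / 2 * s) * (∫⁻ y, γ y) ^ (p / 2 * t)) := by
    intro i
    have := (hcount i).to_subtype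
    calc ∫⁻ y in ⋃ x ∈ u i, B x, ‖f' y‖ₑ ^ p
        ≤ ∑' x : u i, ∫⁻ y in B x, ‖f' y‖ₑ ^ p := by
          rw [Set.biUnion_eq_iUnion]
          exact lintegral_iUnion_le _ _
      _ ≤ ∑' x : u i, D * ((∫⁻ y in B x, φ y) ^ (p / 2 * s) *
            (∫⁻ y in B x, γ y) ^ (p / 2 * t)) := ENNReal.tsum_le_tsum fun x => hball x
      _ ≤ D * ((∑' x : u i, ∫⁻ y in B x, φ y) ^ (p / 2 * s) *
            (∑' x : u i, ∫⁻ y in B x, γ y) ^ (p / 2 * t)) := by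
          rw [ENNReal.tsum_mul_left]
          gcongr
          exact ENNReal.tsum_mul_rpow_le _ _ (by positivity) (by positivity) hpst
      _ ≤ _ := by
          gcongr
          · exact tsum_setLIntegral_le (hcount i) hBm (hu i) φ
          · exact tsum_setLIntegral_le (hcount i) hBm (hu i) γ
  have hcover : S ⊆ ⋃ i : Fin N, ⋃ x ∈ u i, B x := by
    intro x hx
    have := hu' ⟨⟨x, hx⟩, rfl⟩
    simp only [Set.mem_iUnion] at this ⊢
    obtain ⟨i, j, hj, hxj⟩ := this
    exact ⟨i, j, hj, Metric.ball_subset_closedBall hxj⟩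
  calc ∫⁻ x in S, ‖f' x‖ₑ ^ p
      ≤ ∫⁻ x in ⋃ i : Fin N, ⋃ x ∈ u i, B x, ‖f' x‖ₑ ^ p := lintegral_mono_set hcover
    _ ≤ ∑' i : Fin N, ∫⁻ y in ⋃ x ∈ u i, B x, ‖f' y‖ₑ ^ p := lintegral_iUnion_le _ _
    _ ≤ ∑' _ : Fin N, D * ((∫⁻ y, φ y) ^ (p / 2 * s) * (∫⁻ y, γ y) ^ (p / 2 * t)) :=
        ENNReal.tsum_le_tsum hfam
    _ = _ := by
        rw [tsum_fintype, Finset.sum_const, Finset.card_univ, Fintype.card_fin, nsmul_eq_mul]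

/-- An integral over the superlevel sets `{δ ≤ |w|}` that is bounded uniformly in `δ > 0` bounds the
full integral; this removes the cut-off needed to bound the radii in the covering argument. -/
theorem lintegral_enorm_rpow_le_of_forall_superlevel {α : Type*} [MeasurableSpace α]
    {μ : Measure α} {w : α → ℝ} {p : ℝ} (hp : 0 < p) {K : ℝ≥0∞}
    (hK : ∀ δ > 0, ∫⁻ x in {x | δ ≤ |w x|}, ‖w x‖ₑ ^ p ∂μ ≤ K) : ∫⁻ x, ‖w x‖ₑ ^ p ∂μ ≤ K := by
  set T : ℕ → Set α := fun n => {x | 1 / ((n : ℝ) + 1) ≤ |w x|} with hT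
  have hmono : Monotone T := by
    intro a b hab x hx
    rw [hT, Set.mem_ofPred_eq] at hx ⊢
    exact (Nat.one_div_le_one_div hab).trans hx
  have h1 : ∫⁻ x, ‖w x‖ₑ ^ p ∂μ = ∫⁻ x in ⋃ n, T n, ‖w x‖ₑ ^ p ∂μ := by
    symm
    refine setLIntegral_eq_of_support_subset ?_
    intro x hx
    have hx' : 0 < |w x| := by
      rw [abs_pos]
      intro h0
      simp [h0, hp] at hx
    obtain ⟨n, hn⟩ := exists_nat_one_div_lt hx'
    exact Set.mem_iUnion.2 ⟨n, hn.le⟩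
  rw [h1, setLIntegral_iUnion_of_directed _ hmono.directed_le]
  exact iSup_le fun n => hK _ Nat.one_div_pos_of_nat

/-! ### From the line to `ℝⁿ` -/

theorem lintegral_eq_lintegral_lines {m : ℕ} (i : Fin (m + 1))
    {F : EuclideanSpace ℝ (Fin (m + 1)) → ℝ≥0∞} (hF : Measurable F) :
    ∫⁻ x, F x = ∫⁻ y : Fin m → ℝ, ∫⁻ t : ℝ, F (WithLp.toLp 2 (i.insertNth t y)) := by
  have h1 := (PiLp.volume_preserving_toLp (Fin (m + 1))).lintegral_comp hF
  have h2 := (volume_preserving_piFinSuccAbove (fun _ : Fin (m + 1) => ℝ) i).symm.lintegral_comp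
    (f := fun x : Fin (m + 1) → ℝ => F (WithLp.toLp 2 x))
    (hF.comp (PiLp.volume_preserving_toLp (Fin (m + 1))).measurable)
  rw [← h1, ← h2]
  rw [Measure.volume_eq_prod, lintegral_prod_symm]
  · rfl
  · exact (hF.comp ((PiLp.volume_preserving_toLp (Fin (m + 1))).measurable.comp
      (MeasurableEquiv.measurable _))).aemeasurable

theorem toLp_insertNth_eq_add_smul {m : ℕ} (i : Fin (m + 1)) (t : ℝ) (y : Fin m → ℝ) :
    (WithLp.toLp 2 (i.insertNth t y) : EuclideanSpace ℝ (Fin (m + 1))) =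
      WithLp.toLp 2 (i.insertNth 0 y) + t • EuclideanSpace.single i (1 : ℝ) := by
  ext j
  refine Fin.succAboveCases i ?_ (fun k => ?_) j <;> simp

theorem hasDerivAt_comp_line {E : Type*} [NormedAddCommGroup E] [NormedSpace ℝ E] {w : E → ℝ}
    (hw : Differentiable ℝ w) (x e : E) (t : ℝ) :
    HasDerivAt (fun t : ℝ => w (x + t • e)) (fderiv ℝ w (x + t • e) e) t := by
  have h1 : HasDerivAt (fun t : ℝ => x + t • e) e t := by
    simpa using ((hasDerivAt_id t).smul_const e).const_add x
  exact (hw (x + t • e)).hasFDerivAt.comp_hasDerivAt t h1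

/-- The Gagliardo–Nirenberg inequality between the first and the second derivative in a coordinate
direction, obtained from that on the line by Fubini's theorem and Hölder's inequality. -/
theorem exists_lintegral_fderiv_rpow_le : ∃ N : ℕ, ∀ {n : ℕ} (i : Fin n)
    {w h g : EuclideanSpace ℝ (Fin n) → ℝ} {w₁ w₂ : EuclideanSpace ℝ (Fin n) → ℝ}
    (_ : ContDiff ℝ ∞ w)
    (_ : w₁ = fun x => fderiv ℝ w x (EuclideanSpace.single i 1))
    (_ : w₂ = fun x => fderiv ℝ w₁ x (EuclideanSpace.single i 1))
    (_ : Continuous h) (_ : ∀ x, 0 ≤ h x)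
    (_ : Continuous g) (_ : ∀ x, 0 ≤ g x) (_ : Integrable g)
    {p s t M : ℝ} (_ : 0 < p) (_ : 0 < s) (_ : s ≤ 1) (_ : 0 ≤ t) (_ : p / 2 * s + p / 2 * t = 1)
    (_ : 0 ≤ M)
    (_ : ∀ x e a b, a ≤ b → ∫ z in a..b, |w₂ (x + z • e)| ≤
      (b - a) ^ (1 - s) * (∫ z in a..b, h (x + z • e)) ^ s)
    (_ : ∀ x e a b, a ≤ b → ∫ z in a..b, |w (x + z • e)| ≤
      M * (b - a) ^ (1 - t) * (∫ z in a..b, g (x + z • e)) ^ t),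
    ∫⁻ x, ‖w₁ x‖ₑ ^ p ≤
      N * (ENNReal.ofReal (2 * 16 ^ (p / 2) * M ^ (p / 2)) *
        ((∫⁻ x, ENNReal.ofReal (h x)) ^ (p / 2 * s) *
          (∫⁻ x, ENNReal.ofReal (g x)) ^ (p / 2 * t))) := by
  obtain ⟨N, hN⟩ := exists_setLIntegral_deriv_rpow_le
  refine ⟨N, ?_⟩
  intro n i w h g w₁ w₂ hw hw₁ hw₂ hh hh0 hg hg0 hgi p s t M hp hs hs1 ht hpst hM hH hG
  obtain ⟨m, rfl⟩ : ∃ m, n = m + 1 := Nat.exists_eq_succ_of_ne_zero i.pos.ne'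
  have hw₁s : ContDiff ℝ ∞ w₁ := by
    rw [hw₁]; exact (hw.fderiv_right (by simp)).clm_apply contDiff_const
  have hw₂s : ContDiff ℝ ∞ w₂ := by
    rw [hw₂]; exact (hw₁s.fderiv_right (by simp)).clm_apply contDiff_const
  set D := ENNReal.ofReal (2 * 16 ^ (p / 2) * M ^ (p / 2)) with hD
  set e : EuclideanSpace ℝ (Fin (m + 1)) := EuclideanSpace.single i 1 with he
  set γ : EuclideanSpace ℝ (Fin (m + 1)) → ℝ≥0∞ := fun x => ENNReal.ofReal (g x) with hγ
  set φ : EuclideanSpace ℝ (Fin (m + 1)) → ℝ≥0∞ := fun x => ENNReal.ofReal (h x) with hφ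
  have hγm : Measurable γ := ENNReal.measurable_ofReal.comp hg.measurable
  have hφm : Measurable φ := ENNReal.measurable_ofReal.comp hh.measurable
  have hmeas : ∀ {F : EuclideanSpace ℝ (Fin (m + 1)) → ℝ≥0∞}, Measurable F →
      Measurable fun y : Fin m → ℝ => ∫⁻ t : ℝ, F (WithLp.toLp 2 (i.insertNth t y)) := by
    intro F hF
    have h3 : Measurable fun z : (Fin m → ℝ) × ℝ =>
        F (WithLp.toLp 2 (i.insertNth z.2 z.1)) :=
      hF.comp ((PiLp.volume_preserving_toLp (Fin (m + 1))).measurable.comp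
        ((MeasurableEquiv.piFinSuccAbove (fun _ => ℝ) i).symm.measurable.comp measurable_swap))
    exact h3.lintegral_prod_right'
  have hγfin : ∫⁻ y : Fin m → ℝ, ∫⁻ t : ℝ, γ (WithLp.toLp 2 (i.insertNth t y)) ≠ ⊤ := by
    rw [← lintegral_eq_lintegral_lines i hγm]
    exact (hasFiniteIntegral_iff_ofReal (Filter.Eventually.of_forall hg0)).1 hgi.2 |>.ne
  have hae := ae_lt_top (hmeas hγm) hγfin
  have hline : ∀ᵐ y : Fin m → ℝ,
      ∫⁻ t : ℝ, ‖w₁ (WithLp.toLp 2 (i.insertNth t y))‖ₑ ^ p ≤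
      N * (D * ((∫⁻ t : ℝ, φ (WithLp.toLp 2 (i.insertNth t y))) ^ (p / 2 * s) *
        (∫⁻ t : ℝ, γ (WithLp.toLp 2 (i.insertNth t y))) ^ (p / 2 * t))) := by
    filter_upwards [hae] with y hy
    set x : EuclideanSpace ℝ (Fin (m + 1)) := WithLp.toLp 2 (i.insertNth 0 y)
    have hx : ∀ t : ℝ, (WithLp.toLp 2 (i.insertNth t y) : EuclideanSpace ℝ (Fin (m + 1))) =
        x + t • e := fun t => toLp_insertNth_eq_add_smul i t y
    simp only [hx] at hy ⊢
    have hcl : Continuous fun t : ℝ => x + t • e := by fun_prop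
    refine lintegral_enorm_rpow_le_of_forall_superlevel hp fun δ hδ => ?_
    refine hN (f := fun t => w (x + t • e)) (f'' := fun t => w₂ (x + t • e))
      (h := fun t => h (x + t • e)) (g := fun t => g (x + t • e)) ?_ ?_ (hw₂s.continuous.comp hcl)
      (hh.comp hcl) (fun _ => hh0 _) (hg.comp hcl) (fun _ => hg0 _) ?_ hp hs hs1 ht hpst hM hδ
      (hH x e) (hG x e)
    · intro t
      rw [hw₁]
      exact hasDerivAt_comp_line (hw.differentiable (by simp)) x e t
    · intro t
      rw [hw₂]
      exact hasDerivAt_comp_line (hw₁s.differentiable (by simp)) x e t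
    · exact ⟨(hg.comp hcl).aestronglyMeasurable,
        (hasFiniteIntegral_iff_ofReal (Filter.Eventually.of_forall fun _ => hg0 _)).2 hy⟩
  rw [lintegral_eq_lintegral_lines i (hw₁s.continuous.enorm.measurable.pow_const p),
    lintegral_eq_lintegral_lines i hγm, lintegral_eq_lintegral_lines i hφm]
  refine (lintegral_mono_ae hline).trans ?_
  rw [lintegral_const_mul, lintegral_const_mul]
  · gcongr
    exact ENNReal.lintegral_mul_norm_pow_le (hmeas hφm).aemeasurable (hmeas hγm).aemeasurable
      (by positivity) (by positivity) hpst
  · exact ((hmeas hφm).pow_const _).mul ((hmeas hγm).pow_const _)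
  · exact (((hmeas hφm).pow_const _).mul ((hmeas hγm).pow_const _)).const_mul _

theorem intervalIntegral_abs_le_rpow_mul {f : ℝ → ℝ} (hf : Continuous f) {q : ℝ} (hq : 1 ≤ q)
    {a b : ℝ} (hab : a ≤ b) :
    ∫ z in a..b, |f z| ≤ (b - a) ^ (1 - q⁻¹) * (∫ z in a..b, |f z| ^ q) ^ q⁻¹ := by
  have hq0 : 0 < q := by linarith
  have hc : Continuous fun z => |f z| ^ q := hf.abs.rpow_const fun _ => Or.inr hq0.le
  have h0 : 0 ≤ ∫ z in a..b, |f z| ^ q :=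
    intervalIntegral.integral_nonneg hab fun z _ => by positivity
  have hba : 0 ≤ b - a := by linarith
  have hq1 : q⁻¹ ≤ 1 := inv_le_one_of_one_le₀ hq
  rw [← ENNReal.ofReal_le_ofReal_iff (by positivity), ENNReal.ofReal_mul (by positivity),
    ← ENNReal.ofReal_rpow_of_nonneg hba (by linarith),
    ← ENNReal.ofReal_rpow_of_nonneg h0 (by positivity),
    ofReal_intervalIntegral_eq_setLIntegral hf.abs (fun _ => abs_nonneg _) hab,
    ofReal_intervalIntegral_eq_setLIntegral hc (fun _ => by positivity) hab]
  have := ENNReal.lintegral_mul_norm_pow_le (μ := volume.restrict (Set.Icc a b))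
    (f := fun _ => 1) (g := fun z => ENNReal.ofReal (|f z| ^ q)) aemeasurable_const
    (ENNReal.measurable_ofReal.comp hc.measurable).aemeasurable (p := 1 - q⁻¹) (q := q⁻¹)
    (by linarith) (by positivity) (by ring)
  simp only [ENNReal.one_rpow, one_mul, lintegral_const, MeasurableSet.univ,
    Measure.restrict_apply, Set.univ_inter, Real.volume_Icc] at this
  refine le_trans (le_of_eq ?_) this
  refine lintegral_congr fun z => ?_
  rw [ENNReal.ofReal_rpow_of_nonneg (by positivity) (by positivity),
    ← Real.rpow_mul (abs_nonneg _), mul_inv_cancel₀ hq0.ne', Real.rpow_one]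

theorem norm_le_toReal_eLpNorm_top {E : Type*} [TopologicalSpace E] [MeasurableSpace E]
    {μ : Measure E} [μ.IsOpenPosMeasure] {w : E → ℝ} (hw : Continuous w) (h : MemLp w ⊤ μ) (x : E) :
    |w x| ≤ (eLpNorm w ⊤ μ).toReal := by
  have h1 : ∀ᵐ x ∂μ, |w x| ≤ (eLpNorm w ⊤ μ).toReal := by
    rw [eLpNorm_exponent_top]
    filter_upwards [enorm_ae_le_eLpNormEssSup w μ] with x hx
    have h2 : eLpNormEssSup w μ ≠ ⊤ := by
      rw [← eLpNorm_exponent_top]; exact h.2.ne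
    simpa using ENNReal.toReal_mono h2 hx
  have h2 := (Measure.dense_of_ae h1)
  have h3 : IsClosed {x | |w x| ≤ (eLpNorm w ⊤ μ).toReal} :=
    isClosed_le hw.abs continuous_const
  have h4 := h2 x
  rwa [h3.closure_eq] at h4

/-- If `2 / P = 1 / Q + 1 / R` with `R < ∞`, then
`‖∂ᵢ w‖_P² ≤ C ‖∂ᵢ² w‖_R ‖w‖_Q` for all smooth `w ∈ L^Q(ℝⁿ)`. -/
theorem exists_eLpNorm_partial_sq_le {P Q R : ℝ≥0∞} (hQ : 1 ≤ Q) (hR : 1 ≤ R) (hR' : R ≠ ⊤)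
    (hP : P⁻¹ + P⁻¹ = Q⁻¹ + R⁻¹) : ∃ C : ℝ≥0, ∀ {n : ℕ} (i : Fin n)
    {w : EuclideanSpace ℝ (Fin n) → ℝ} {w₁ w₂ : EuclideanSpace ℝ (Fin n) → ℝ}
    (_ : ContDiff ℝ ∞ w)
    (_ : w₁ = fun x => fderiv ℝ w x (EuclideanSpace.single i 1))
    (_ : w₂ = fun x => fderiv ℝ w₁ x (EuclideanSpace.single i 1)) (_ : MemLp w Q),
    eLpNorm w₁ P volume ^ 2 ≤ C * (eLpNorm w Q volume * eLpNorm w₂ R volume) := by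
  obtain ⟨N, hN⟩ := exists_lintegral_fderiv_rpow_le
  have hR0 : R ≠ 0 := (zero_lt_one.trans_le hR).ne'
  have hQ0 : Q ≠ 0 := (zero_lt_one.trans_le hQ).ne'
  have hRi : R⁻¹ ≠ ⊤ := ENNReal.inv_ne_top.2 hR0
  have hQi : Q⁻¹ ≠ ⊤ := ENNReal.inv_ne_top.2 hQ0
  have hP0 : P ≠ 0 := by
    rintro rfl
    rw [ENNReal.inv_zero, top_add] at hP
    exact ENNReal.add_ne_top.2 ⟨hQi, hRi⟩ hP.symm
  have hPt : P ≠ ⊤ := by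
    rintro rfl
    rw [ENNReal.inv_top, add_zero] at hP
    have := (add_eq_zero.1 hP.symm).2
    exact hR' (ENNReal.inv_eq_zero.1 this)
  set p := P.toReal with hp
  set r := R.toReal with hr
  set t := Q⁻¹.toReal with ht
  have hp0 : 0 < p := ENNReal.toReal_pos hP0 hPt
  have hr1 : 1 ≤ r := by
    rw [hr, ← ENNReal.toReal_one]; exact ENNReal.toReal_mono hR' hR
  have hreal : p⁻¹ + p⁻¹ = t + r⁻¹ := by
    have := congrArg ENNReal.toReal hP
    rwa [ENNReal.toReal_add (ENNReal.inv_ne_top.2 hP0) (ENNReal.inv_ne_top.2 hP0),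
      ENNReal.toReal_add hQi hRi, ENNReal.toReal_inv P, ENNReal.toReal_inv R] at this
  have hpst : p / 2 * r⁻¹ + p / 2 * t = 1 := by
    rw [← mul_add, add_comm, ← hreal]; field_simp; norm_num
  have ht0 : 0 ≤ t := ENNReal.toReal_nonneg
  refine ⟨((N : ℝ≥0) * Real.toNNReal (2 * 16 ^ (p / 2))) ^ (2 / p), ?_⟩
  intro n i w w₁ w₂ hw hw₁ hw₂ hwQ
  have hw₁s : ContDiff ℝ ∞ w₁ := by
    rw [hw₁]; exact (hw.fderiv_right (by simp)).clm_apply contDiff_const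
  have hw₂s : ContDiff ℝ ∞ w₂ := by
    rw [hw₂]; exact (hw₁s.fderiv_right (by simp)).clm_apply contDiff_const
  -- the factor `M` and the density `g` encode the norm of `w` for finite and infinite `Q` alike
  obtain ⟨M, g, hM, hg, hg0, hgi, hG, hMg⟩ : ∃ (M : ℝ) (g : EuclideanSpace ℝ (Fin n) → ℝ),
      0 ≤ M ∧ Continuous g ∧ (∀ x, 0 ≤ g x) ∧ Integrable g ∧
      (∀ x e a b, a ≤ b → ∫ z in a..b, |w (x + z • e)| ≤
        M * (b - a) ^ (1 - t) * (∫ z in a..b, g (x + z • e)) ^ t) ∧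
      ENNReal.ofReal M * (∫⁻ x, ENNReal.ofReal (g x)) ^ t = eLpNorm w Q volume := by
    by_cases hQt : Q = ⊤
    · subst hQt
      have ht' : t = 0 := by simp [ht]
      have hb := norm_le_toReal_eLpNorm_top hw.continuous hwQ
      refine ⟨(eLpNorm w ⊤ volume).toReal, fun _ => 0, ENNReal.toReal_nonneg, continuous_const,
        fun _ => le_rfl, integrable_zero _ _ _, ?_, ?_⟩
      · intro x e a b hab
        have hcl : Continuous fun z : ℝ => |w (x + z • e)| :=
          (hw.continuous.comp (by fun_prop)).abs
        rw [ht', Real.rpow_zero, mul_one, sub_zero, Real.rpow_one]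
        have := intervalIntegral.integral_mono_on hab (hcl.intervalIntegrable a b)
          (intervalIntegrable_const (μ := volume)) (fun z _ => hb (x + z • e))
        rwa [intervalIntegral.integral_const, smul_eq_mul, mul_comm] at this
      · rw [ht', ENNReal.rpow_zero, mul_one, ENNReal.ofReal_toReal hwQ.2.ne]
    · set q := Q.toReal with hq
      have hq1 : 1 ≤ q := by
        rw [hq, ← ENNReal.toReal_one]; exact ENNReal.toReal_mono hQt hQ
      have htq : t = q⁻¹ := ENNReal.toReal_inv Q
      refine ⟨1, fun x => |w x| ^ q, zero_le_one,
        hw.continuous.abs.rpow_const fun _ => Or.inr (by linarith), fun x => by positivity, ?_, ?_,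
        ?_⟩
      · exact hwQ.integrable_norm_rpow hQ0 hQt
      · intro x e a b hab
        rw [htq, one_mul]
        exact intervalIntegral_abs_le_rpow_mul (hw.continuous.comp (by fun_prop)) hq1 hab
      · rw [ENNReal.ofReal_one, one_mul, eLpNorm_eq_lintegral_rpow_enorm_toReal hQ0 hQt, htq,
          one_div]
        congr 1
        refine lintegral_congr fun x => ?_
        rw [← ENNReal.ofReal_rpow_of_nonneg (abs_nonneg _) (by linarith), ← Real.norm_eq_abs,
          ofReal_norm]
  have hmain := hN i (h := fun x => |w₂ x| ^ r) hw hw₁ hw₂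
    (hw₂s.continuous.abs.rpow_const fun _ => Or.inr (by linarith)) (fun x => by positivity)
    hg hg0 hgi hp0 (s := r⁻¹) (by positivity) (inv_le_one_of_one_le₀ hr1) ht0 hpst hM
    (fun x e a b hab => intervalIntegral_abs_le_rpow_mul
      (hw₂s.continuous.comp (by fun_prop)) hr1 hab) hG
  have hwR : (∫⁻ x, ENNReal.ofReal (|w₂ x| ^ r)) ^ r⁻¹ = eLpNorm w₂ R volume := by
    rw [eLpNorm_eq_lintegral_rpow_enorm_toReal hR0 hR', one_div]
    congr 1
    refine lintegral_congr fun x => ?_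
    rw [← ENNReal.ofReal_rpow_of_nonneg (abs_nonneg _) (by linarith), ← Real.norm_eq_abs,
      ofReal_norm]
  have hexp : p / 2 * (2 / p) = 1 := by field_simp
  have h2p : 0 ≤ 2 / p := by positivity
  calc eLpNorm w₁ P volume ^ 2 = (∫⁻ x, ‖w₁ x‖ₑ ^ p) ^ (2 / p) := by
        rw [eLpNorm_eq_lintegral_rpow_enorm_toReal hP0 hPt, ← ENNReal.rpow_natCast,
          ← ENNReal.rpow_mul]
        congr 1
        push_cast; ring
    _ ≤ _ := ENNReal.rpow_le_rpow hmain h2p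
    _ = (N * ENNReal.ofReal (2 * 16 ^ (p / 2))) ^ (2 / p) * ((ENNReal.ofReal M *
          (∫⁻ x, ENNReal.ofReal (g x)) ^ t) * (∫⁻ x, ENNReal.ofReal (|w₂ x| ^ r)) ^ r⁻¹) := by
        rw [ENNReal.ofReal_mul (by positivity), ← ENNReal.ofReal_rpow_of_nonneg hM (by positivity)]
        simp only [ENNReal.mul_rpow_of_nonneg _ _ h2p, ← ENNReal.rpow_mul]
        rw [mul_right_comm _ r⁻¹, mul_right_comm _ t, hexp, one_mul, one_mul, ENNReal.rpow_one]
        ring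
    _ = _ := by
        rw [hMg, hwR, ENNReal.coe_rpow_of_nonneg _ h2p, ENNReal.coe_mul]
        rfl

/-! ### Log-convex sequences -/

/-- Interpolation of the `j`-th term between the terms `0` and `j + 1`, from which the general case
follows by induction. -/
theorem NNReal.pow_succ_le_of_logConvex {c : ℕ → ℝ≥0} {k : ℕ}
    (h : ∀ i, i + 1 < k → c (i + 1) ^ 2 ≤ c i * c (i + 2)) {j : ℕ} (hj : j < k) :
    c j ^ (j + 1) ≤ c 0 * c (j + 1) ^ j := by
  induction j with
  | zero => simp
  | succ j ih =>
    rcases eq_or_ne (c (j + 1)) 0 with h0 | h0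
    · simp [h0]
    have h1 : c (j + 1) ^ (j + 2) * c (j + 1) ^ j ≤ c 0 * c (j + 2) ^ (j + 1) * c (j + 1) ^ j :=
      calc c (j + 1) ^ (j + 2) * c (j + 1) ^ j = (c (j + 1) ^ 2) ^ (j + 1) := by ring
        _ ≤ (c j * c (j + 2)) ^ (j + 1) := pow_le_pow_left₀ zero_le (h j hj) _
        _ = c j ^ (j + 1) * c (j + 2) ^ (j + 1) := mul_pow _ _ _
        _ ≤ c 0 * c (j + 1) ^ j * c (j + 2) ^ (j + 1) := by
            gcongr; exact ih (by omega)
        _ = _ := by ring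
    exact le_of_mul_le_mul_right h1 (pow_pos (pos_iff_ne_zero.2 h0) j)

theorem NNReal.pow_le_of_logConvex {c : ℕ → ℝ≥0} {j k : ℕ}
    (h : ∀ i, i + 1 < k → c (i + 1) ^ 2 ≤ c i * c (i + 2)) (hj : j ≤ k) :
    c j ^ k ≤ c 0 ^ (k - j) * c k ^ j := by
  induction k, hj using Nat.le_induction with
  | base => simp
  | succ k hjk ih =>
    rcases Nat.eq_zero_or_pos k with rfl | hk
    · obtain rfl : j = 0 := by omega
      simp
    have h1 := ih fun i hi => h i (by omega)
    have h2 := NNReal.pow_succ_le_of_logConvex h (Nat.lt_succ_self k)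
    obtain ⟨d, rfl⟩ := Nat.exists_eq_add_of_le hjk
    refine le_of_pow_le_pow_left₀ hk.ne' zero_le ?_
    calc (c j ^ (j + d + 1)) ^ (j + d) = (c j ^ (j + d)) ^ (j + d + 1) := by
          rw [← pow_mul, ← pow_mul, mul_comm]
      _ ≤ (c 0 ^ (j + d - j) * c (j + d) ^ j) ^ (j + d + 1) := pow_le_pow_left₀ zero_le h1 _
      _ = c 0 ^ (d * (j + d + 1)) * (c (j + d) ^ (j + d + 1)) ^ j := by
          rw [Nat.add_sub_cancel_left, mul_pow, ← pow_mul, ← pow_mul, ← pow_mul,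
            mul_comm j (j + d + 1)]
      _ ≤ c 0 ^ (d * (j + d + 1)) * (c 0 * c (j + d + 1) ^ (j + d)) ^ j := by gcongr
      _ = (c 0 ^ (j + d + 1 - j) * c (j + d + 1) ^ j) ^ (j + d) := by
          rw [show j + d + 1 - j = d + 1 by omega]; ring

/-- A sequence that is log-convex up to a factor becomes log-convex when its `i`-th term is
multiplied by `B ^ i²`. -/
theorem NNReal.pow_le_of_sq_le_mul {a : ℕ → ℝ≥0} {B : ℝ≥0} (hB : 1 ≤ B) {j k : ℕ}
    (h : ∀ i, i + 1 < k → a (i + 1) ^ 2 ≤ B ^ 2 * (a i * a (i + 2))) (hj : j ≤ k) :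
    a j ^ k ≤ B ^ (k ^ 2 * j) * (a 0 ^ (k - j) * a k ^ j) := by
  have h1 := NNReal.pow_le_of_logConvex (c := fun i => B ^ i ^ 2 * a i) (k := k) (fun i hi => by
    calc (B ^ (i + 1) ^ 2 * a (i + 1)) ^ 2 = (B ^ (i + 1) ^ 2) ^ 2 * a (i + 1) ^ 2 := mul_pow _ _ _
      _ ≤ (B ^ (i + 1) ^ 2) ^ 2 * (B ^ 2 * (a i * a (i + 2))) := by gcongr; exact h i hi
      _ = B ^ i ^ 2 * a i * (B ^ (i + 2) ^ 2 * a (i + 2)) := by ring) hj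
  calc a j ^ k ≤ (B ^ j ^ 2 * a j) ^ k :=
        pow_le_pow_left₀ zero_le (le_mul_of_one_le_left zero_le (one_le_pow₀ hB)) _
    _ ≤ _ := h1
    _ = _ := by simp only [mul_pow, ← pow_mul]; ring

/-! ### Integrability at intermediate exponents -/

theorem MeasureTheory.MemLp.of_exponent_le_of_le {α E : Type*} [MeasurableSpace α]
    {μ : Measure α} [NormedAddCommGroup E] {f : α → E} {a b p : ℝ≥0∞} (ha0 : a ≠ 0)
    (ha : MemLp f a μ) (hb : MemLp f b μ) (hap : a ≤ p) (hpb : p ≤ b) : MemLp f p μ := by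
  refine ⟨ha.1, ?_⟩
  have hp0 : p ≠ 0 := (ha0.bot_lt.trans_le hap).ne'
  rcases eq_or_ne p ⊤ with rfl | hpt
  · rw [top_le_iff.1 hpb] at hb; exact hb.2
  have hat : a ≠ ⊤ := (hap.trans_lt hpt.lt_top).ne
  have hapr : a.toReal ≤ p.toReal := ENNReal.toReal_mono hpt hap
  rw [eLpNorm_lt_top_iff_lintegral_rpow_enorm_lt_top hp0 hpt]
  have ha2 := (eLpNorm_lt_top_iff_lintegral_rpow_enorm_lt_top ha0 hat).1 ha.2
  rcases eq_or_ne b ⊤ with rfl | hbt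
  · set K := eLpNormEssSup f μ with hK
    have hKt : K < ⊤ := by rw [hK, ← eLpNorm_exponent_top]; exact hb.2
    calc ∫⁻ x, ‖f x‖ₑ ^ p.toReal ∂μ
        ≤ ∫⁻ x, K ^ (p.toReal - a.toReal) * ‖f x‖ₑ ^ a.toReal ∂μ := by
          refine lintegral_mono_ae ?_
          filter_upwards [enorm_ae_le_eLpNormEssSup f μ] with x hx
          calc ‖f x‖ₑ ^ p.toReal = ‖f x‖ₑ ^ (p.toReal - a.toReal) * ‖f x‖ₑ ^ a.toReal := by
                rw [← ENNReal.rpow_add_of_nonneg _ _ (by linarith) ENNReal.toReal_nonneg]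
                congr 1; ring
            _ ≤ _ := by gcongr
      _ = K ^ (p.toReal - a.toReal) * ∫⁻ x, ‖f x‖ₑ ^ a.toReal ∂μ :=
          lintegral_const_mul' _ _ (ENNReal.rpow_ne_top_of_nonneg (by linarith) hKt.ne)
      _ < ⊤ := ENNReal.mul_lt_top (ENNReal.rpow_lt_top_of_nonneg (by linarith) hKt.ne) ha2
  · have hb0 : b ≠ 0 := (hp0.bot_lt.trans_le hpb).ne'
    have hpbr : p.toReal ≤ b.toReal := ENNReal.toReal_mono hbt hpb
    have hb2 := (eLpNorm_lt_top_iff_lintegral_rpow_enorm_lt_top hb0 hbt).1 hb.2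
    calc ∫⁻ x, ‖f x‖ₑ ^ p.toReal ∂μ
        ≤ ∫⁻ x, ‖f x‖ₑ ^ a.toReal + ‖f x‖ₑ ^ b.toReal ∂μ := by
          refine lintegral_mono fun x => ?_
          rcases le_total ‖f x‖ₑ 1 with h1 | h1
          · exact (ENNReal.rpow_le_rpow_of_exponent_ge h1 hapr).trans le_self_add
          · exact (ENNReal.rpow_le_rpow_of_exponent_le h1 hpbr).trans le_add_self
      _ = ∫⁻ x, ‖f x‖ₑ ^ a.toReal ∂μ + ∫⁻ x, ‖f x‖ₑ ^ b.toReal ∂μ :=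
          lintegral_add_left' (ha.1.enorm.pow_const _) _
      _ < ⊤ := ENNReal.add_lt_top.2 ⟨ha2, hb2⟩

/-! ### Partial derivatives and mollification -/

section PartialDeriv

variable {n m : ℕ} {φ ψ u : EuclideanSpace ℝ (Fin n) → ℝ}

theorem partialDeriv_zero (α : Fin 0 → Fin n) : partialDeriv α φ = φ := by
  funext x
  simp [partialDeriv]

theorem partialDeriv_cons (hφ : ContDiff ℝ ∞ φ) (i : Fin n) (α : Fin m → Fin n) :
    partialDeriv (Fin.cons i α) φ =
      fun x => fderiv ℝ (partialDeriv α φ) x (EuclideanSpace.single i 1) := by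
  funext x
  have hd : DifferentiableAt ℝ (iteratedFDeriv ℝ m φ) x :=
    (hφ.differentiable_iteratedFDeriv (by exact_mod_cast ENat.natCast_lt_top m)) x
  let L := ContinuousMultilinearMap.apply ℝ (fun _ : Fin m => EuclideanSpace ℝ (Fin n)) ℝ
    fun i => EuclideanSpace.single (α i) (1 : ℝ)
  have h1 : HasFDerivAt (partialDeriv α φ) (L.comp (fderiv ℝ (iteratedFDeriv ℝ m φ) x)) x :=
    (L.hasFDerivAt (x := iteratedFDeriv ℝ m φ x)).comp x hd.hasFDerivAt
  rw [h1.fderiv, partialDeriv, iteratedFDeriv_succ_apply_left]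
  rfl

theorem contDiff_partialDeriv (hφ : ContDiff ℝ ∞ φ) (α : Fin m → Fin n) :
    ContDiff ℝ ∞ (partialDeriv α φ) := by
  have h1 : ContDiff ℝ ∞ (iteratedFDeriv ℝ m φ) :=
    hφ.iteratedFDeriv_right (m := ∞) (i := m) (by exact_mod_cast le_rfl)
  exact (ContinuousMultilinearMap.apply ℝ (fun _ : Fin m => EuclideanSpace ℝ (Fin n)) ℝ
        fun i => EuclideanSpace.single (α i) (1 : ℝ)).contDiff.comp h1

theorem hasCompactSupport_partialDeriv (hφ : HasCompactSupport φ) (α : Fin m → Fin n) :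
    HasCompactSupport (partialDeriv α φ) :=
  (hφ.iteratedFDeriv (𝕜 := ℝ) m).comp_left (g := fun L : ContinuousMultilinearMap ℝ
    (fun _ : Fin m => EuclideanSpace ℝ (Fin n)) ℝ =>
      L fun i => EuclideanSpace.single (α i) (1 : ℝ)) rfl

theorem partialDeriv_comp_const_sub (hφ : ContDiff ℝ ∞ φ) (α : Fin m → Fin n)
    (x : EuclideanSpace ℝ (Fin n)) :
    partialDeriv α (fun t => φ (x - t)) = fun t => (-1) ^ m * partialDeriv α φ (x - t) := by
  have hφ' : ContDiff ℝ ∞ fun t => φ (x - t) := hφ.comp (contDiff_const.sub contDiff_id)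
  induction m with
  | zero => simp [partialDeriv_zero]
  | succ m ih =>
    rw [← Fin.cons_self_tail α, partialDeriv_cons hφ', partialDeriv_cons hφ, ih]
    funext t
    have hd : DifferentiableAt ℝ (partialDeriv (Fin.tail α) φ) (x - t) :=
      (contDiff_partialDeriv hφ _).differentiable (by simp) _
    have h1 : HasFDerivAt (fun t => x - t) (-ContinuousLinearMap.id ℝ _) t :=
      (hasFDerivAt_id t).const_sub x
    have h2 : HasFDerivAt (fun t => (-1) ^ m * partialDeriv (Fin.tail α) φ (x - t)) _ t :=
      (hd.hasFDerivAt.comp t h1).const_mul ((-1) ^ m)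
    rw [h2.fderiv]
    simp only [FunLike.coe_smul, Pi.smul_apply, ContinuousLinearMap.comp_apply,
      neg_apply, ContinuousLinearMap.id_apply, map_neg, smul_eq_mul]
    ring

theorem partialDeriv_convolution (hu : LocallyIntegrable u) (hψ : ContDiff ℝ ∞ ψ)
    (hψc : HasCompactSupport ψ) (α : Fin m → Fin n) :
    partialDeriv α (convolution u ψ (ContinuousLinearMap.lsmul ℝ ℝ) volume) =
      convolution u (partialDeriv α ψ) (ContinuousLinearMap.lsmul ℝ ℝ) volume := by
  have hs : ContDiff ℝ ∞ (convolution u ψ (ContinuousLinearMap.lsmul ℝ ℝ) volume) :=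
    hψc.contDiff_convolution_right _ hu hψ
  induction m with
  | zero => simp [partialDeriv_zero]
  | succ m ih =>
    rw [← Fin.cons_self_tail α, partialDeriv_cons hs, partialDeriv_cons hψ, ih]
    have hβ : ContDiff ℝ ∞ (partialDeriv (Fin.tail α) ψ) := contDiff_partialDeriv hψ _
    have hβc : HasCompactSupport (partialDeriv (Fin.tail α) ψ) :=
      hasCompactSupport_partialDeriv hψc _
    funext x
    rw [(hβc.hasFDerivAt_convolution_right (ContinuousLinearMap.lsmul ℝ ℝ) hu
      (hβ.of_le (by simp)) x).fderiv,
      convolution_precompR_apply _ hu (hβc.fderiv ℝ) (hβ.continuous_fderiv (by simp))]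

/-- Testing the weak gradient against `t ↦ ψ (x - t)` moves the derivatives from `ψ` to `u`. -/
theorem IsWeakGradient.convolution_partialDeriv
    {D : EuclideanSpace ℝ (Fin n) → EuclideanSpace ℝ (Fin m → Fin n)} (hD : IsWeakGradient m u D)
    (hψ : ContDiff ℝ ∞ ψ) (hψc : HasCompactSupport ψ) (α : Fin m → Fin n) :
    convolution u (partialDeriv α ψ) (ContinuousLinearMap.lsmul ℝ ℝ) volume =
      convolution (fun x => D x α) ψ (ContinuousLinearMap.lsmul ℝ ℝ) volume := by
  funext x
  have hφ : ContDiff ℝ ∞ fun t => ψ (x - t) := hψ.comp (contDiff_const.sub contDiff_id)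
  have hφc : HasCompactSupport fun t => ψ (x - t) :=
    hψc.comp_homeomorph (Homeomorph.subLeft x)
  have h1 := hD.integral_eq α _ hφ hφc
  rw [partialDeriv_comp_const_sub hψ] at h1
  simp only [convolution_def, ContinuousLinearMap.lsmul_apply, smul_eq_mul]
  have h2 : ∀ t, u t * ((-1) ^ m * partialDeriv α ψ (x - t)) =
      (-1) ^ m * (u t * partialDeriv α ψ (x - t)) := fun t => by ring
  simp only [h2, integral_const_mul] at h1
  exact mul_left_cancel₀ (pow_ne_zero m (by norm_num)) h1

end PartialDeriv

/-- Young's convolution inequality with one factor in `L¹`. -/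
theorem eLpNorm_convolution_le {E : Type*} [NormedAddCommGroup E] [InnerProductSpace ℝ E]
    [FiniteDimensional ℝ E] [MeasurableSpace E] [BorelSpace E] {u ψ : E → ℝ} {p : ℝ≥0∞}
    (hp : 1 ≤ p) (hu : AEStronglyMeasurable u) (hψ : Continuous ψ)
    (hψi : Integrable ψ) :
    eLpNorm (convolution u ψ (ContinuousLinearMap.lsmul ℝ ℝ) volume) p volume ≤
      eLpNorm ψ 1 volume * eLpNorm u p volume := by
  set K := eLpNorm ψ 1 volume with hK
  have hKt : K ≠ ⊤ := (memLp_one_iff_integrable.2 hψi).2.ne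
  have hKx : ∀ x : E, ∫⁻ t, ‖ψ (x - t)‖ₑ = K := fun x => by
    rw [hK, eLpNorm_one_eq_lintegral_enorm, lintegral_sub_left_eq_self (fun t => ‖ψ t‖ₑ) x]
  have hKt' : ∀ t : E, ∫⁻ x, ‖ψ (x - t)‖ₑ = K := fun t => by
    rw [hK, eLpNorm_one_eq_lintegral_enorm, lintegral_sub_right_eq_self (fun t => ‖ψ t‖ₑ) t]
  have hpt : ∀ x, ‖convolution u ψ (ContinuousLinearMap.lsmul ℝ ℝ) volume x‖ₑ ≤
      ∫⁻ t, ‖u t‖ₑ * ‖ψ (x - t)‖ₑ := fun x => by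
    refine (enorm_integral_le_lintegral_enorm _).trans (le_of_eq ?_)
    simp only [ContinuousLinearMap.lsmul_apply, smul_eq_mul, enorm_mul]
  have hψx : ∀ x : E, Measurable fun t => ‖ψ (x - t)‖ₑ := fun x =>
    (hψ.comp (by fun_prop)).enorm.measurable
  have hψt : ∀ t : E, Measurable fun x => ‖ψ (x - t)‖ₑ := fun t =>
    (hψ.comp (by fun_prop)).enorm.measurable
  rcases eq_or_ne p ⊤ with rfl | hpt'
  · simp only [eLpNorm_exponent_top]
    refine eLpNormEssSup_le_of_ae_enorm_bound (Filter.Eventually.of_forall fun x => ?_)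
    refine (hpt x).trans ?_
    calc ∫⁻ t, ‖u t‖ₑ * ‖ψ (x - t)‖ₑ ≤ ∫⁻ t, eLpNormEssSup u volume * ‖ψ (x - t)‖ₑ := by
          refine lintegral_mono_ae ?_
          filter_upwards [enorm_ae_le_eLpNormEssSup u volume] with t ht
          gcongr
      _ = eLpNormEssSup u volume * ∫⁻ t, ‖ψ (x - t)‖ₑ := lintegral_const_mul _ (hψx x)
      _ = _ := by rw [hKx, mul_comm]
  have hp0 : p ≠ 0 := (zero_lt_one.trans_le hp).ne'
  set a := p.toReal with ha
  have ha1 : 1 ≤ a := by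
    rw [ha, ← ENNReal.toReal_one]; exact ENNReal.toReal_mono hpt' hp
  have ha0 : 0 < a := by linarith
  have hai : a⁻¹ ≤ 1 := inv_le_one_of_one_le₀ ha1
  have hbound : ∀ x, ‖convolution u ψ (ContinuousLinearMap.lsmul ℝ ℝ) volume x‖ₑ ^ a ≤
      K ^ (a - 1) * ∫⁻ t, ‖u t‖ₑ ^ a * ‖ψ (x - t)‖ₑ := by
    intro x
    have h1 := ENNReal.lintegral_mul_norm_pow_le (μ := (volume : Measure E))
      (f := fun t => ‖u t‖ₑ ^ a * ‖ψ (x - t)‖ₑ) (g := fun t => ‖ψ (x - t)‖ₑ)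
      ((hu.enorm.pow_const a).mul (hψx x).aemeasurable) (hψx x).aemeasurable
      (p := a⁻¹) (q := 1 - a⁻¹) (by positivity) (by linarith) (by ring)
    have h2 : ∀ t, (‖u t‖ₑ ^ a * ‖ψ (x - t)‖ₑ) ^ a⁻¹ * ‖ψ (x - t)‖ₑ ^ (1 - a⁻¹) =
        ‖u t‖ₑ * ‖ψ (x - t)‖ₑ := fun t => by
      rw [ENNReal.mul_rpow_of_nonneg _ _ (by positivity), ← ENNReal.rpow_mul,
        mul_inv_cancel₀ ha0.ne', ENNReal.rpow_one, mul_assoc,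
        ← ENNReal.rpow_add_of_nonneg _ _ (by positivity) (by linarith), add_sub_cancel,
        ENNReal.rpow_one]
    simp only [h2, hKx] at h1
    refine (ENNReal.rpow_le_rpow ((hpt x).trans h1) ha0.le).trans (le_of_eq ?_)
    rw [ENNReal.mul_rpow_of_nonneg _ _ ha0.le, ← ENNReal.rpow_mul, ← ENNReal.rpow_mul,
      inv_mul_cancel₀ ha0.ne', ENNReal.rpow_one, sub_mul, inv_mul_cancel₀ ha0.ne', one_mul,
      mul_comm]
  have hKa : K ^ (a - 1) ≠ ⊤ := ENNReal.rpow_ne_top_of_nonneg (by linarith) hKt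
  have hmain : ∫⁻ x, ‖convolution u ψ (ContinuousLinearMap.lsmul ℝ ℝ) volume x‖ₑ ^ a ≤
      K ^ a * ∫⁻ t, ‖u t‖ₑ ^ a :=
    calc ∫⁻ x, ‖convolution u ψ (ContinuousLinearMap.lsmul ℝ ℝ) volume x‖ₑ ^ a
        ≤ ∫⁻ x, K ^ (a - 1) * ∫⁻ t, ‖u t‖ₑ ^ a * ‖ψ (x - t)‖ₑ := lintegral_mono hbound
      _ = K ^ (a - 1) * ∫⁻ x, ∫⁻ t, ‖u t‖ₑ ^ a * ‖ψ (x - t)‖ₑ := lintegral_const_mul' _ _ hKa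
      _ = K ^ (a - 1) * ∫⁻ t, ∫⁻ x, ‖u t‖ₑ ^ a * ‖ψ (x - t)‖ₑ := by
          rw [lintegral_lintegral_swap]
          refine AEMeasurable.mul ?_ ?_
          · exact (hu.enorm.pow_const a).comp_snd
          · exact (hψ.comp (continuous_fst.sub continuous_snd)).enorm.measurable.aemeasurable
      _ = K ^ (a - 1) * ((∫⁻ t, ‖u t‖ₑ ^ a) * K) := by
          congr 1
          have : ∀ t, ∫⁻ x, ‖u t‖ₑ ^ a * ‖ψ (x - t)‖ₑ = ‖u t‖ₑ ^ a * K := fun t => by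
            rw [lintegral_const_mul _ (hψt t), hKt']
          simp only [this]
          rw [lintegral_mul_const' _ _ hKt]
      _ = K ^ a * ∫⁻ t, ‖u t‖ₑ ^ a := by
          rw [mul_comm _ K, ← mul_assoc]
          congr 1
          nth_rewrite 2 [← ENNReal.rpow_one K]
          rw [← ENNReal.rpow_add_of_nonneg _ _ (by linarith) zero_le_one, sub_add_cancel]
  rw [eLpNorm_eq_lintegral_rpow_enorm_toReal hp0 hpt',
    eLpNorm_eq_lintegral_rpow_enorm_toReal hp0 hpt', ← ha]
  refine (ENNReal.rpow_le_rpow hmain (by positivity)).trans (le_of_eq ?_)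
  rw [ENNReal.mul_rpow_of_nonneg _ _ (by positivity), ← ENNReal.rpow_mul, one_div,
    mul_inv_cancel₀ ha0.ne', ENNReal.rpow_one]

/-! ### Interpolation for smooth functions -/

/-- The largest `L^p` norm of a partial derivative of order `m` of a smooth function `w`. -/
noncomputable def supPartialNorm {n : ℕ} (m : ℕ) (p : ℝ≥0∞) (w : EuclideanSpace ℝ (Fin n) → ℝ) :
    ℝ≥0∞ :=
  Finset.univ.sup fun α : Fin m → Fin n => eLpNorm (partialDeriv α w) p volume

theorem eLpNorm_partialDeriv_le_supPartialNorm {n m : ℕ} (α : Fin m → Fin n) (p : ℝ≥0∞)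
    (w : EuclideanSpace ℝ (Fin n) → ℝ) :
    eLpNorm (partialDeriv α w) p volume ≤ supPartialNorm m p w :=
  Finset.le_sup (f := fun α : Fin m → Fin n => eLpNorm (partialDeriv α w) p volume)
    (Finset.mem_univ α)

theorem ENNReal.le_rpow_half_of_sq_le {x X : ℝ≥0∞} (h : x ^ 2 ≤ X) : x ≤ X ^ (1 / 2 : ℝ) := by
  have := ENNReal.rpow_le_rpow h (z := 1 / 2) (by norm_num)
  rwa [← ENNReal.rpow_natCast, ← ENNReal.rpow_mul,
    show ((2 : ℕ) : ℝ) * (1 / 2) = 1 by norm_num, ENNReal.rpow_one] at this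

/-- The directional inequality, applied to every partial derivative of order `i` of `w`. -/
theorem exists_supPartialNorm_sq_le (n i : ℕ) {P Q R : ℝ≥0∞} (hQ : 1 ≤ Q) (hR : 1 ≤ R)
    (hR' : R ≠ ⊤) (hP : P⁻¹ + P⁻¹ = Q⁻¹ + R⁻¹) :
    ∃ C : ℝ≥0, ∀ w : EuclideanSpace ℝ (Fin n) → ℝ, ContDiff ℝ ∞ w →
      (∀ α : Fin i → Fin n, MemLp (partialDeriv α w) Q) →
      supPartialNorm (i + 1) P w ^ 2 ≤
        C * (supPartialNorm i Q w * supPartialNorm (i + 2) R w) := by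
  obtain ⟨C, hC⟩ := exists_eLpNorm_partial_sq_le hQ hR hR' hP
  refine ⟨C, fun w hw hmem => ?_⟩
  -- Each `∂^α w` of order `i + 1` is `∂ₑ (∂^β w)`; its further derivative in the same direction `e`
  -- is again a partial derivative of `w`, of order `i + 2`.
  set X := C * (supPartialNorm i Q w * supPartialNorm (i + 2) R w) with hX
  have h1 : supPartialNorm (i + 1) P w ≤ X ^ (1 / 2 : ℝ) := by
    refine Finset.sup_le fun α _ => ENNReal.le_rpow_half_of_sq_le ?_
    have hα : Fin.cons (α 0) (Fin.tail α) = α := Fin.cons_self_tail α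
    have hw₁ : partialDeriv α w = fun x =>
        fderiv ℝ (partialDeriv (Fin.tail α) w) x (EuclideanSpace.single (α 0) 1) := by
      rw [← partialDeriv_cons hw, hα]
    refine (hC (α 0) (contDiff_partialDeriv hw (Fin.tail α)) hw₁
      (partialDeriv_cons hw (α 0) α) (hmem _)).trans ?_
    rw [hX]
    gcongr
    · exact eLpNorm_partialDeriv_le_supPartialNorm _ _ _
    · exact eLpNorm_partialDeriv_le_supPartialNorm _ _ _
  calc supPartialNorm (i + 1) P w ^ 2 ≤ (X ^ (1 / 2 : ℝ)) ^ 2 := by gcongr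
    _ = X := by
      rw [← ENNReal.rpow_natCast, ← ENNReal.rpow_mul,
        show 1 / 2 * ((2 : ℕ) : ℝ) = 1 by norm_num, ENNReal.rpow_one]

/-- The exponent for `∇ⁱ` on the segment between the exponent `q` of `∇⁰` and the exponent `r` of
`∇ᵏ`: its reciprocal is affine in `i`. It is only used for `i ≤ k`. -/
noncomputable def interpExponent (k : ℕ) (q r : ℝ≥0∞) (i : ℕ) : ℝ≥0∞ :=
  ((i : ℝ≥0∞) * (k * r)⁻¹ + ((k - i : ℕ) : ℝ≥0∞) * (k * q)⁻¹)⁻¹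

section Exponent

variable {k : ℕ} {q r : ℝ≥0∞}

theorem natCast_mul_inv_natCast_mul (hk : k ≠ 0) (r : ℝ≥0∞) :
    (k : ℝ≥0∞) * (k * r)⁻¹ = r⁻¹ := by
  rw [ENNReal.mul_inv (Or.inl (by exact_mod_cast hk)) (Or.inl (ENNReal.natCast_ne_top k)),
    ← mul_assoc, ENNReal.mul_inv_cancel (by exact_mod_cast hk) (ENNReal.natCast_ne_top k), one_mul]

theorem interpExponent_zero (hk : k ≠ 0) : interpExponent k q r 0 = q := by
  simp [interpExponent, natCast_mul_inv_natCast_mul hk]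

theorem interpExponent_self (hk : k ≠ 0) : interpExponent k q r k = r := by
  simp [interpExponent, natCast_mul_inv_natCast_mul hk]

theorem inv_interpExponent_add_self {i : ℕ} (hi : i + 1 < k) :
    (interpExponent k q r (i + 1))⁻¹ + (interpExponent k q r (i + 1))⁻¹ =
      (interpExponent k q r i)⁻¹ + (interpExponent k q r (i + 2))⁻¹ := by
  obtain ⟨d, rfl⟩ := Nat.exists_eq_add_of_lt hi
  simp only [interpExponent, inv_inv]
  rw [show i + 1 + d + 1 - (i + 1) = d + 1 by omega, show i + 1 + d + 1 - i = d + 2 by omega,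
    show i + 1 + d + 1 - (i + 2) = d by omega]
  push_cast
  ring

theorem min_le_interpExponent (hk : k ≠ 0) {i : ℕ} (hi : i ≤ k) :
    min q r ≤ interpExponent k q r i := by
  rw [interpExponent, ENNReal.le_inv_iff_le_inv]
  set T := max (k * r)⁻¹ (k * q)⁻¹ with hT
  calc (i : ℝ≥0∞) * (k * r)⁻¹ + ((k - i : ℕ) : ℝ≥0∞) * (k * q)⁻¹
      ≤ i * T + ((k - i : ℕ) : ℝ≥0∞) * T := by
        gcongr
        · exact le_max_left _ _
        · exact le_max_right _ _
    _ = k * T := by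
        rw [← add_mul, ← Nat.cast_add, Nat.add_sub_cancel' hi]
    _ = (min q r)⁻¹ := by
        rcases le_total q r with h | h
        · rw [hT, max_eq_right (ENNReal.inv_le_inv.2 (by gcongr)),
            natCast_mul_inv_natCast_mul hk, min_eq_left h]
        · rw [hT, max_eq_left (ENNReal.inv_le_inv.2 (by gcongr)),
            natCast_mul_inv_natCast_mul hk, min_eq_right h]

theorem interpExponent_le_max (hk : k ≠ 0) {i : ℕ} (hi : i ≤ k) :
    interpExponent k q r i ≤ max q r := by
  rw [interpExponent, ENNReal.inv_le_iff_inv_le]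
  set T := min (k * r)⁻¹ (k * q)⁻¹ with hT
  calc (max q r)⁻¹ = k * T := by
        rcases le_total q r with h | h
        · rw [hT, min_eq_left (ENNReal.inv_le_inv.2 (by gcongr)),
            natCast_mul_inv_natCast_mul hk, max_eq_right h]
        · rw [hT, min_eq_right (ENNReal.inv_le_inv.2 (by gcongr)),
            natCast_mul_inv_natCast_mul hk, max_eq_left h]
    _ = i * T + ((k - i : ℕ) : ℝ≥0∞) * T := by
        rw [← add_mul, ← Nat.cast_add, Nat.add_sub_cancel' hi]
    _ ≤ _ := by
        gcongr
        · exact min_le_left _ _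
        · exact min_le_right _ _

theorem one_le_interpExponent (hk : k ≠ 0) (hq : 1 ≤ q) (hr : 1 ≤ r) {i : ℕ} (hi : i ≤ k) :
    1 ≤ interpExponent k q r i :=
  (le_min hq hr).trans (min_le_interpExponent hk hi)

theorem interpExponent_ne_top (hr' : r ≠ ⊤) {i : ℕ} (hi : i ≠ 0) :
    interpExponent k q r i ≠ ⊤ := by
  rw [interpExponent, ENNReal.inv_ne_top]
  intro h
  have h1 := (add_eq_zero.1 h).1
  rw [mul_eq_zero, ENNReal.inv_eq_zero] at h1
  rcases h1 with h1 | h1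
  · exact hi (by exact_mod_cast h1)
  · exact ENNReal.mul_ne_top (ENNReal.natCast_ne_top k) hr' h1

end Exponent

/-- The interpolation inequality for smooth functions, by log-convexity of the norms of the
derivatives. The norms have to be finite, which holds as all derivatives lie in `L^q ∩ L^r`. -/
theorem exists_supPartialNorm_pow_le (n : ℕ) {j k : ℕ} (hjk : j < k) {q r : ℝ≥0∞} (hq : 1 ≤ q)
    (hr : 1 ≤ r) (hr' : r ≠ ⊤) :
    ∃ C : ℝ≥0, ∀ w : EuclideanSpace ℝ (Fin n) → ℝ, ContDiff ℝ ∞ w →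
      (∀ (i : ℕ) (α : Fin i → Fin n), MemLp (partialDeriv α w) q ∧ MemLp (partialDeriv α w) r) →
      supPartialNorm j (interpExponent k q r j) w ^ k ≤
        C * (supPartialNorm 0 q w ^ (k - j) * supPartialNorm k r w ^ j) := by
  have hk : k ≠ 0 := by omega
  have hex : ∀ i, ∃ C : ℝ≥0, i + 1 < k → ∀ w : EuclideanSpace ℝ (Fin n) → ℝ, ContDiff ℝ ∞ w →
      (∀ α : Fin i → Fin n, MemLp (partialDeriv α w) (interpExponent k q r i)) →
      supPartialNorm (i + 1) (interpExponent k q r (i + 1)) w ^ 2 ≤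
        C * (supPartialNorm i (interpExponent k q r i) w *
          supPartialNorm (i + 2) (interpExponent k q r (i + 2)) w) := by
    intro i
    by_cases hi : i + 1 < k
    · obtain ⟨C, hC⟩ := exists_supPartialNorm_sq_le n i
        (one_le_interpExponent hk hq hr (show i ≤ k by omega))
        (one_le_interpExponent hk hq hr (show i + 2 ≤ k by omega))
        (interpExponent_ne_top hr' (by omega)) (inv_interpExponent_add_self (q := q) (r := r) hi)
      exact ⟨C, fun _ => hC⟩
    · exact ⟨0, fun h => absurd h hi⟩
  choose C hC using hex
  set B : ℝ≥0 := 1 + ∑ i ∈ Finset.range k, C i with hB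
  have hB1 : 1 ≤ B := le_self_add
  have hCB : ∀ i < k, C i ≤ B ^ 2 := fun i hi =>
    calc C i ≤ ∑ i ∈ Finset.range k, C i :=
          Finset.single_le_sum (fun _ _ => zero_le) (Finset.mem_range.2 hi)
      _ ≤ B := le_add_self
      _ ≤ B ^ 2 := le_self_pow₀ hB1 two_ne_zero
  refine ⟨B ^ (k ^ 2 * j), fun w hw hmem => ?_⟩
  have hmem' : ∀ i ≤ k, ∀ α : Fin i → Fin n,
      MemLp (partialDeriv α w) (interpExponent k q r i) := by
    intro i hi α
    have h1 := min_le_interpExponent (q := q) (r := r) hk hi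
    have h2 := interpExponent_le_max (q := q) (r := r) hk hi
    have hmin : min q r ≠ 0 := (zero_lt_one.trans_le (le_min hq hr)).ne'
    refine MemLp.of_exponent_le_of_le hmin ?_ ?_ h1 h2
    · rcases min_choice q r with h | h <;> rw [h]
      exacts [(hmem i α).1, (hmem i α).2]
    · rcases max_choice q r with h | h <;> rw [h]
      exacts [(hmem i α).1, (hmem i α).2]
  have hfin : ∀ i ≤ k, supPartialNorm i (interpExponent k q r i) w ≠ ⊤ := by
    intro i hi
    refine (Finset.sup_lt_iff ENNReal.coe_lt_top).2 (fun α _ => (hmem' i hi α).2) |>.ne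
  have hcoe : ∀ i ≤ k, (((supPartialNorm i (interpExponent k q r i) w).toNNReal : ℝ≥0) : ℝ≥0∞) =
      supPartialNorm i (interpExponent k q r i) w := fun i hi => ENNReal.coe_toNNReal (hfin i hi)
  have hmain := NNReal.pow_le_of_sq_le_mul
    (a := fun i => (supPartialNorm i (interpExponent k q r i) w).toNNReal) hB1 (k := k)
    (fun i hi => by
      rw [← ENNReal.coe_le_coe]
      push_cast
      rw [hcoe i (by omega), hcoe (i + 1) (by omega), hcoe (i + 2) (by omega)]
      refine (hC i hi w hw (hmem' i (by omega))).trans ?_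
      gcongr
      exact_mod_cast hCB i (by omega)) hjk.le
  rw [← ENNReal.coe_le_coe] at hmain
  push_cast at hmain
  rw [hcoe j hjk.le, hcoe 0 (by omega), hcoe k le_rfl, interpExponent_zero hk,
    interpExponent_self hk] at hmain
  push_cast
  exact hmain

/-! ### Passage to weak gradients -/

theorem eLpNorm_apply_le {n m : ℕ} {D : EuclideanSpace ℝ (Fin n) → EuclideanSpace ℝ (Fin m → Fin n)}
    (α : Fin m → Fin n) (p : ℝ≥0∞) :
    eLpNorm (fun x => D x α) p volume ≤ eLpNorm D p volume :=
  eLpNorm_mono fun x => PiLp.norm_apply_le (D x) α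

theorem eLpNorm_le_sum_apply {n m : ℕ}
    {D : EuclideanSpace ℝ (Fin n) → EuclideanSpace ℝ (Fin m → Fin n)}
    (hD : AEStronglyMeasurable D) {p : ℝ≥0∞} (hp : 1 ≤ p) :
    eLpNorm D p volume ≤ ∑ α, eLpNorm (fun x => D x α) p volume := by
  have hDα : ∀ α, AEStronglyMeasurable fun x => D x α := fun α =>
    (EuclideanSpace.proj (𝕜 := ℝ) α).continuous.comp_aestronglyMeasurable hD
  have h1 : D = ∑ α, fun x => EuclideanSpace.single α (D x α) := by
    funext x
    ext β
    simp [Finset.sum_apply]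
  calc eLpNorm D p volume = eLpNorm (∑ α, fun x => EuclideanSpace.single α (D x α)) p volume := by
        rw [← h1]
    _ ≤ ∑ α, eLpNorm (fun x => EuclideanSpace.single α (D x α)) p volume := by
        refine eLpNorm_sum_le (fun α _ => ?_) hp
        have hc : Continuous fun c : ℝ => (EuclideanSpace.single α c : EuclideanSpace ℝ _) := by
          have : (fun c : ℝ => (EuclideanSpace.single α c : EuclideanSpace ℝ (Fin m → Fin n))) =
              fun c => c • EuclideanSpace.single α (1 : ℝ) := by
            funext c; ext β; simp
          rw [this]; fun_prop
        exact hc.comp_aestronglyMeasurable (hDα α)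
    _ = ∑ α, eLpNorm (fun x => D x α) p volume := by
        refine Finset.sum_congr rfl fun α _ => eLpNorm_congr_norm_ae ?_
        exact Filter.Eventually.of_forall fun x => by simp

theorem MeasureTheory.LocallyIntegrable.euclidean_apply {n m : ℕ}
    {D : EuclideanSpace ℝ (Fin n) → EuclideanSpace ℝ (Fin m → Fin n)} (hD : LocallyIntegrable D)
    (α : Fin m → Fin n) : LocallyIntegrable fun x => D x α := fun x =>
  (hD x).imp fun _ hs => ⟨hs.1, (EuclideanSpace.proj (𝕜 := ℝ) α).integrable_comp hs.2⟩

/-- Smooth mollifiers: unit mass in `L¹`, and convergence almost everywhere on all locally integrable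
functions. -/
theorem exists_mollifier (n : ℕ) : ∃ ψ : ℕ → EuclideanSpace ℝ (Fin n) → ℝ,
    (∀ i, ContDiff ℝ ∞ (ψ i)) ∧ (∀ i, HasCompactSupport (ψ i)) ∧
    (∀ i, eLpNorm (ψ i) 1 volume = 1) ∧
    ∀ f : EuclideanSpace ℝ (Fin n) → ℝ, LocallyIntegrable f → ∀ᵐ x, Filter.Tendsto
      (fun i => convolution f (ψ i) (ContinuousLinearMap.lsmul ℝ ℝ) volume x) Filter.atTop
      (nhds (f x)) := by
  let ρ : ℕ → ContDiffBump (0 : EuclideanSpace ℝ (Fin n)) := fun i =>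
    ⟨1 / ((i : ℝ) + 1), 2 / ((i : ℝ) + 1), by positivity, by gcongr; norm_num⟩
  refine ⟨fun i => (ρ i).normed volume, fun i => (ρ i).contDiff_normed,
    fun i => (ρ i).hasCompactSupport_normed, fun i => ?_, fun f hf => ?_⟩
  · rw [eLpNorm_one_eq_lintegral_enorm, ← ofReal_integral_norm_eq_lintegral_enorm
      (ρ i).integrable_normed]
    have h1 : ∀ x, ‖(ρ i).normed volume x‖ = (ρ i).normed volume x := fun x =>
      Real.norm_of_nonneg ((ρ i).nonneg_normed x)
    simp only [h1]
    rw [(ρ i).integral_normed, ENNReal.ofReal_one]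
  · have h1 := ContDiffBump.ae_convolution_tendsto_right_of_locallyIntegrable (φ := ρ)
      (l := Filter.atTop) (K := 2) (μ := volume) ?_ ?_ hf
    · filter_upwards [h1] with x hx
      refine hx.congr fun i => ?_
      rw [convolution_eq_swap]
      simp only [convolution_def, ContinuousLinearMap.lsmul_apply, smul_eq_mul, mul_comm]
    · have h2 := (tendsto_one_div_add_atTop_nhds_zero_nat (𝕜 := ℝ)).const_mul 2
      rw [mul_zero] at h2
      refine h2.congr fun i => ?_
      change 2 * (1 / ((i : ℝ) + 1)) = 2 / ((i : ℝ) + 1)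
      ring
    · refine Filter.Eventually.of_forall fun i => le_of_eq ?_
      change 2 / ((i : ℝ) + 1) = 2 * (1 / ((i : ℝ) + 1))
      ring

/-- A function is almost everywhere equal to its weak gradient of order zero. -/
theorem IsWeakGradient.ae_eq_of_order_zero {n : ℕ} {u : EuclideanSpace ℝ (Fin n) → ℝ}
    {D : EuclideanSpace ℝ (Fin n) → EuclideanSpace ℝ (Fin 0 → Fin n)} (hD : IsWeakGradient 0 u D)
    (α : Fin 0 → Fin n) : (fun x => D x α) =ᵐ[volume] u := by
  obtain ⟨ψ, hψs, hψc, -, hconv⟩ := exists_mollifier n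
  filter_upwards [hconv u hD.locallyIntegrable,
    hconv _ (hD.locallyIntegrable_grad.euclidean_apply α)] with x h1 h2
  refine tendsto_nhds_unique h2 (h1.congr fun i => ?_)
  rw [← hD.convolution_partialDeriv (hψs i) (hψc i) α, partialDeriv_zero]

theorem mainTheorem1 (n j k : ℕ) (hjk : j < k) (p q r : ℝ≥0∞)
    (hq : 1 ≤ q) (hr : 1 ≤ r) (hr' : r ≠ ⊤)
    (hp : 1 / p = (j : ℝ≥0∞) / (k * r) + ((k : ℝ≥0∞) - j) / (k * q)) :
    ∃ C : ℝ≥0, ∀ u : EuclideanSpace ℝ (Fin n) → ℝ,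
      MemLp u q volume → MemSobolev k r u →
      ∀ (Dj : EuclideanSpace ℝ (Fin n) → EuclideanSpace ℝ (Fin j → Fin n))
        (Dk : EuclideanSpace ℝ (Fin n) → EuclideanSpace ℝ (Fin k → Fin n)),
        IsWeakGradient j u Dj → IsWeakGradient k u Dk →
        eLpNorm Dj p volume ≤
          C * eLpNorm Dk r volume ^ ((j : ℝ) / k) * eLpNorm u q volume ^ (1 - (j : ℝ) / k) := by
  have hk : k ≠ 0 := by omega
  have hk0 : (0 : ℝ) < k := by exact_mod_cast Nat.pos_of_ne_zero hk
  have hpe : p = interpExponent k q r j := by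
    rw [interpExponent, ENNReal.natCast_sub, ← div_eq_mul_inv, ← div_eq_mul_inv, ← hp, one_div,
      inv_inv]
  have hp1 : 1 ≤ p := hpe ▸ one_le_interpExponent hk hq hr hjk.le
  obtain ⟨C, hC⟩ := exists_supPartialNorm_pow_le n hjk hq hr hr'
  refine ⟨Fintype.card (Fin j → Fin n) * C ^ (1 / (k : ℝ)), fun u hu hus Dj Dk hDj hDk => ?_⟩
  -- `u ∈ L^r` is the order-zero part of the Sobolev hypothesis
  have hur : MemLp u r := by
    obtain ⟨D, hD, hDr⟩ := hus 0 (Nat.zero_le _)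
    exact ((memLp_congr_ae (hD.ae_eq_of_order_zero Fin.elim0)).1
      ⟨(hD.locallyIntegrable_grad.euclidean_apply _).aestronglyMeasurable,
        (eLpNorm_apply_le _ r).trans_lt hDr.2⟩)
  set X := (C : ℝ≥0∞) ^ (1 / (k : ℝ)) * eLpNorm Dk r volume ^ ((j : ℝ) / k) *
    eLpNorm u q volume ^ (1 - (j : ℝ) / k) with hX
  obtain ⟨ψ, hψs, hψc, hψ1, hconv⟩ := exists_mollifier n
  have hloc := hDj.locallyIntegrable
  let w : ℕ → EuclideanSpace ℝ (Fin n) → ℝ := fun i =>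
    convolution u (ψ i) (ContinuousLinearMap.lsmul ℝ ℝ) volume
  have hws : ∀ i, ContDiff ℝ ∞ (w i) := fun i =>
    (hψc i).contDiff_convolution_right _ hloc (hψs i)
  have hwmem : ∀ i (m : ℕ) (α : Fin m → Fin n), MemLp (partialDeriv α (w i)) q ∧
      MemLp (partialDeriv α (w i)) r := by
    intro i m α
    have hc := contDiff_partialDeriv (hψs i) α
    have hi := hc.continuous.integrable_of_hasCompactSupport (μ := volume)
      (hasCompactSupport_partialDeriv (hψc i) α)
    have hm := (contDiff_partialDeriv (hws i) α).continuous.aestronglyMeasurable (μ := volume)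
    have h1 : ∀ {b : ℝ≥0∞}, 1 ≤ b → MemLp u b → MemLp (partialDeriv α (w i)) b := by
      intro b hb hub
      refine ⟨hm, ?_⟩
      rw [partialDeriv_convolution hloc (hψs i) (hψc i)]
      exact (eLpNorm_convolution_le hb hub.1 hc.continuous hi).trans_lt
        (ENNReal.mul_lt_top (memLp_one_iff_integrable.2 hi).2 hub.2)
    exact ⟨h1 hq hu, h1 hr hur⟩
  have hwD : ∀ i {m : ℕ} {D : EuclideanSpace ℝ (Fin n) → EuclideanSpace ℝ (Fin m → Fin n)},
      IsWeakGradient m u D → ∀ α, partialDeriv α (w i) =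
        convolution (fun x => D x α) (ψ i) (ContinuousLinearMap.lsmul ℝ ℝ) volume := by
    intro i m D hD α
    rw [partialDeriv_convolution hloc (hψs i) (hψc i),
      hD.convolution_partialDeriv (hψs i) (hψc i)]
  have hyoung : ∀ i {f : EuclideanSpace ℝ (Fin n) → ℝ} {b : ℝ≥0∞}, 1 ≤ b →
      AEStronglyMeasurable f → eLpNorm (convolution f (ψ i) (ContinuousLinearMap.lsmul ℝ ℝ) volume)
        b volume ≤ eLpNorm f b volume := by
    intro i f b hb hf
    have := eLpNorm_convolution_le hb hf (hψs i).continuous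
      ((hψs i).continuous.integrable_of_hasCompactSupport (hψc i))
    rwa [hψ1, one_mul] at this
  have hsmooth : ∀ i, supPartialNorm j p (w i) ≤ X := by
    intro i
    have h1 := hC (w i) (hws i) (hwmem i)
    rw [← hpe] at h1
    have h2 : supPartialNorm 0 q (w i) ≤ eLpNorm u q volume := by
      refine Finset.sup_le fun α _ => ?_
      rw [partialDeriv_zero]
      exact hyoung i hq hu.1
    have h3 : supPartialNorm k r (w i) ≤ eLpNorm Dk r volume := by
      refine Finset.sup_le fun α _ => ?_
      rw [hwD i hDk α]
      exact (hyoung i hr (hDk.locallyIntegrable_grad.euclidean_apply α).aestronglyMeasurable).trans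
        (eLpNorm_apply_le α r)
    have h4 : supPartialNorm j p (w i) ^ k ≤
        C * (eLpNorm u q volume ^ (k - j) * eLpNorm Dk r volume ^ j) :=
      h1.trans (by gcongr)
    have h5 := ENNReal.rpow_le_rpow h4 (z := 1 / (k : ℝ)) (by positivity)
    rw [← ENNReal.rpow_natCast, ← ENNReal.rpow_mul, mul_one_div_cancel hk0.ne',
      ENNReal.rpow_one] at h5
    refine h5.trans (le_of_eq ?_)
    have hz : 0 ≤ 1 / (k : ℝ) := by positivity
    rw [hX, ENNReal.mul_rpow_of_nonneg _ _ hz, ENNReal.mul_rpow_of_nonneg _ _ hz,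
      ← ENNReal.rpow_natCast, ← ENNReal.rpow_natCast, ← ENNReal.rpow_mul, ← ENNReal.rpow_mul,
      mul_one_div, mul_one_div, Nat.cast_sub hjk.le, sub_div, div_self hk0.ne', mul_assoc,
      mul_comm (eLpNorm Dk r volume ^ _)]
  have hcomp : ∀ α, eLpNorm (fun x => Dj x α) p volume ≤ X := by
    intro α
    have hDα := hDj.locallyIntegrable_grad.euclidean_apply α
    refine (Lp.eLpNorm_lim_le_liminf_eLpNorm (f := fun i => partialDeriv α (w i))
      (fun i => (contDiff_partialDeriv (hws i) α).continuous.aestronglyMeasurable) _ ?_).trans ?_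
    · filter_upwards [hconv _ hDα] with x hx
      exact hx.congr fun i => by rw [hwD i hDj α]
    · refine Filter.liminf_le_of_frequently_le' (Filter.Frequently.of_forall fun i => ?_)
      exact (eLpNorm_partialDeriv_le_supPartialNorm α p (w i)).trans (hsmooth i)
  calc eLpNorm Dj p volume ≤ ∑ α, eLpNorm (fun x => Dj x α) p volume :=
        eLpNorm_le_sum_apply hDj.locallyIntegrable_grad.aestronglyMeasurable hp1
    _ ≤ ∑ _ : Fin j → Fin n, X := Finset.sum_le_sum fun α _ => hcomp α
    _ = _ := by
        rw [Finset.sum_const, Finset.card_univ, nsmul_eq_mul, hX]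
        push_cast
        rw [ENNReal.coe_rpow_of_nonneg _ (by positivity)]
        simp only [mul_assoc]
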